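/- Proposition. All categories are over $\mathbb{C}$. A fusion category is a rigid abelian $\mathbb{C}$-linear semisimple monoidal category with bilinear tensor product, finite-dimensional Hom-spaces, finitely many isomorphism classes of simple objects, and simple unit object; it is pointed if every simple object is invertible for $\otimes$. For a braided fusion category $\mathcal{B}$ with braiding $c$, the Müger centre $\mathcal{Z}_2(\mathcal{B})$ is the full subcategory of objects $Y$ such that $c_{Y,X}\circ c_{X,Y}=\mathrm{id}_{X\otimes Y}$ for all $X\in\mathcal{B}$. The category $\mathcal{B}$ is slightly degenerate if $\mathcal{Z}_2(\mathcal{B})$ is braided equivalent (by a $\mathbb{C}$-linear functor) to the category $\mathrm{SVec}$ of finite-dimensional super vector spaces, i.e. $\mathrm{Rep}(\mathbb{Z}/2\mathbb{Z})$ with braiding $x\otimes y\mapsto(-1)^{|x||y|}y\otimes x$, and non-degenerate if $\mathcal{Z}_2(\mathcal{B})$ is braided equivalent to the category of finite-dimensional vector spaces. A modular category is a non-degenerate spherical braided fusion category. A minimal modular extension of $\mathcal{B}$ is a pair $(\mathcal{M},i)$ of a modular category $\mathcal{M}$ and a fully faithful $\mathbb{C}$-linear braided monoidal functor $i:\mathcal{B}\to\mathcal{M}$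 such that $$\operatorname{FPdim}(\mathcal{M})=\operatorname{FPdim}(\mathcal{B})\,\operatorname{FPdim}(\mathcal{Z}_2(\mathcal{B})),$$ where $\operatorname{FPdim}$ of a category is the sum of the squares of the Frobenius-Perron dimensions of its simple objects (up to isomorphism). Let $\mathcal{B}$ be a slightly degenerate pointed braided fusion category. Then $\mathcal{B}$ has a minimal modular extension. -/

import Mathlib

open CategoryTheory MonoidalCategory Limits

universe v u v' u'

noncomputable section

namespace FusionCat

/-! ### Fusion categories over the complex numbers -/

section Fusion

attribute [local instance] Abelian.hasFiniteBiproducts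

variable (C : Type u) [Category.{v} C] [Preadditive C]

/-- Isomorphism of objects, as a relation on the simple objects. -/
def simpleSetoid : Setoid {X : C // Simple X} where
  r X Y := Nonempty (X.1 ≅ Y.1)
  iseqv :=
    ⟨fun _ => ⟨Iso.refl _⟩, fun ⟨e⟩ => ⟨e.symm⟩, fun ⟨e⟩ ⟨e'⟩ => ⟨e.trans e'⟩⟩

/-- The set of isomorphism classes of simple objects. -/
def Irr : Type u := Quotient (simpleSetoid C)

variable {C} in
/-- A simple object representing a class in `Irr C`. -/
def Irr.rep (i : Irr C) : C := (Quotient.out i).1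

/-- A rigid abelian `ℂ`-linear monoidal category (with bilinear tensor product) is a fusion category
if it is semisimple, has finite-dimensional `Hom`-spaces, finitely many isomorphism classes of
simple objects, and a simple unit object. -/
class IsFusion (C : Type u) [Category.{v} C] [Abelian C] [Linear ℂ C] [MonoidalCategory C]
    [MonoidalPreadditive C] [MonoidalLinear ℂ C] [RigidCategory C] : Prop where
  finiteDimensional_hom : ∀ X Y : C, FiniteDimensional ℂ (X ⟶ Y)
  semisimple : ∀ X : C, ∃ (n : ℕ) (S : Fin n → C),
    (∀ i, Simple (S i)) ∧ Nonempty (X ≅ ⨁ S)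
  finite_irr : Finite (Irr C)
  simple_unit : Simple (𝟙_ C)

/-- An object is invertible if it has an inverse for the tensor product, up to isomorphism. -/
def IsInvertibleObj {C : Type u} [Category.{v} C] [MonoidalCategory C] (X : C) : Prop :=
  ∃ Y : C, Nonempty (X ⊗ Y ≅ 𝟙_ C) ∧ Nonempty (Y ⊗ X ≅ 𝟙_ C)

/-- Pointed: every simple object is invertible. -/
def IsPointed [MonoidalCategory C] : Prop :=
  ∀ X : C, Simple X → IsInvertibleObj X

end Fusion

/-! ### Frobenius-Perron dimensions -/

section FPdim

variable {C : Type u} [Category.{v} C] [Preadditive C] [Linear ℂ C] [MonoidalCategory C]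

/-- The multiplicity of the simple object `j` in `X ⊗ i`. -/
def fusionMult (X : C) (i j : Irr C) : ℕ :=
  Module.finrank ℂ (j.rep ⟶ X ⊗ i.rep)

/-- The Frobenius-Perron dimension of an object: the largest non-negative real eigenvalue of
the matrix of left multiplication by `X` in the basis `Irr C` of the Grothendieck ring. -/
def objFPdim (X : C) : ℝ :=
  sSup {r : ℝ | 0 ≤ r ∧ ∃ w : Irr C → ℝ, w ≠ 0 ∧
    ∀ j : Irr C, ∑ᶠ i : Irr C, (fusionMult X i j : ℝ) * w i = r * w j}

variable (C) in
/-- The Frobenius-Perron dimension of a category: the sum of the squares of the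
Frobenius-Perron dimensions of its simple objects. -/
def FPdim : ℝ := ∑ᶠ i : Irr C, objFPdim i.rep ^ 2

end FPdim

/-! ### The Müger centre -/

section Muger

variable (B : Type u) [Category.{v} B] [MonoidalCategory B] [BraidedCategory B]

/-- The objects `Y` whose double braiding with every object is the identity. -/
def isTransparent : ObjectProperty B := fun Y =>
  ∀ X : B, (β_ X Y).hom ≫ (β_ Y X).hom = 𝟙 (X ⊗ Y)

instance : (isTransparent B).IsMonoidal where
  prop_unit X := by simp
  prop_tensor Y Z hY hZ X := by
    have h1 := hY X
    have h2 := hZ X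
    rw [BraidedCategory.braiding_tensor_right_hom, BraidedCategory.braiding_tensor_left_hom]
    simp only [Category.assoc, Iso.inv_hom_id_assoc]
    rw [← MonoidalCategory.whiskerLeft_comp_assoc, h2, MonoidalCategory.whiskerLeft_id,
      Category.id_comp, Iso.hom_inv_id_assoc, ← comp_whiskerRight_assoc, h1, id_whiskerRight,
      Category.id_comp, Iso.inv_hom_id]

/-- The Müger centre: the full subcategory of transparent objects, with the
inherited linear and braided monoidal structure. -/
abbrev MugerCenter : Type u := (isTransparent B).FullSubcategory

end Muger

/-- Equivalence of `ℂ`-linear braided monoidal categories. -/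
def BraidedEquivalent (C : Type u) [Category.{v} C] [Preadditive C] [Linear ℂ C]
    [MonoidalCategory C] [BraidedCategory C]
    (D : Type u') [Category.{v'} D] [Preadditive D] [Linear ℂ D]
    [MonoidalCategory D] [BraidedCategory D] : Prop :=
  ∃ (F : C ⥤ D) (_ : F.Braided), F.Additive ∧ F.Linear ℂ ∧ F.IsEquivalence

/-! ### Super vector spaces -/

/-- Finite-dimensional complex representations of `ℤ/2ℤ`; equivalently,
`ℤ/2ℤ`-graded vector spaces, the generator acting by `(-1)^degree`. -/
abbrev RepZ2 : Type 1 := FDRep ℂ (Multiplicative (ZMod 2))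

namespace RepZ2

/-- The action of the generator of `ℤ/2ℤ`. -/
def parity (V : RepZ2) : V ⟶ V where
  hom := Action.ρ V (Multiplicative.ofAdd 1)
  comm g := by
    change Action.ρ V _ * Action.ρ V _ = Action.ρ V _ * Action.ρ V _
    rw [← map_mul, ← map_mul, mul_comm]

lemma parity_sq (V : RepZ2) : parity V ≫ parity V = 𝟙 V := by
  ext1
  change Action.ρ V _ * Action.ρ V _ = 1
  rw [← map_mul, ← map_one (Action.ρ V)]; rfl

lemma parity_naturality {V W : RepZ2} (f : V ⟶ W) : parity V ≫ f = f ≫ parity W := by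
  ext1; exact f.comm _

/-- The sign operator `x ⊗ y ↦ (-1)^(|x||y|) x ⊗ y`: on homogeneous vectors
`(1 + (-1)^|x| + (-1)^|y| - (-1)^(|x|+|y|)) / 2 = (-1)^(|x||y|)`. -/
def sgn (V W : RepZ2) : V ⊗ W ⟶ V ⊗ W :=
  (2⁻¹ : ℂ) • (𝟙 (V ⊗ W) + parity V ▷ W + V ◁ parity W - (parity V ⊗ₘ parity W))

lemma sgn_sq (V W : RepZ2) : sgn V W ≫ sgn V W = 𝟙 _ := by
  have h1 : parity V ▷ W ≫ parity V ▷ W = 𝟙 _ := by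
    rw [← comp_whiskerRight, parity_sq, id_whiskerRight]
  have h2 : V ◁ parity W ≫ V ◁ parity W = 𝟙 _ := by
    rw [← MonoidalCategory.whiskerLeft_comp, parity_sq, MonoidalCategory.whiskerLeft_id]
  have h3 : V ◁ parity W ≫ parity V ▷ W = parity V ▷ W ≫ V ◁ parity W := whisker_exchange _ _
  have h1' {Z} (g : V ⊗ W ⟶ Z) : parity V ▷ W ≫ parity V ▷ W ≫ g = g := by
    rw [← Category.assoc, h1, Category.id_comp]
  have h3' {Z} (g : V ⊗ W ⟶ Z) :
      V ◁ parity W ≫ parity V ▷ W ≫ g = parity V ▷ W ≫ V ◁ parity W ≫ g := by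
    rw [← Category.assoc, h3, Category.assoc]
  simp only [sgn, MonoidalCategory.tensorHom_def, Linear.smul_comp, Linear.comp_smul,
    Preadditive.add_comp, Preadditive.comp_add, Preadditive.sub_comp, Preadditive.comp_sub,
    Category.id_comp, Category.comp_id, Category.assoc, h1, h2, h3, h1', h3']
  module

lemma sgn_naturality_left {V V' : RepZ2} (f : V ⟶ V') (W : RepZ2) :
    f ▷ W ≫ sgn V' W = sgn V W ≫ f ▷ W := by
  simp only [sgn, MonoidalCategory.tensorHom_def, Linear.smul_comp, Linear.comp_smul,
    Preadditive.add_comp, Preadditive.comp_add, Preadditive.sub_comp, Preadditive.comp_sub,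
    Category.id_comp, Category.comp_id, Category.assoc, whisker_exchange, ← comp_whiskerRight,
    ← comp_whiskerRight_assoc, parity_naturality]

lemma sgn_naturality_right {V V' : RepZ2} (f : V ⟶ V') (W : RepZ2) :
    W ◁ f ≫ sgn W V' = sgn W V ≫ W ◁ f := by
  simp only [sgn, tensorHom_def', Linear.smul_comp, Linear.comp_smul,
    Preadditive.add_comp, Preadditive.comp_add, Preadditive.sub_comp, Preadditive.comp_sub,
    Category.id_comp, Category.comp_id, Category.assoc, ← whisker_exchange,
    ← MonoidalCategory.whiskerLeft_comp, ← MonoidalCategory.whiskerLeft_comp_assoc,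
    parity_naturality]

/-- The super braiding `x ⊗ y ↦ (-1)^(|x||y|) y ⊗ x`. -/
def superSwap (V W : RepZ2) : V ⊗ W ≅ W ⊗ V :=
  ⟨sgn V W ≫ (β_ V W).hom, (β_ V W).inv ≫ sgn V W,
    by simp [sgn_sq], by simp [reassoc_of% sgn_sq]⟩

/-! Linear algebra behind the hexagon identities. -/

section LinearAlgebra

open TensorProduct

variable {U V W : Type} [AddCommGroup U] [AddCommGroup V] [AddCommGroup W]
  [Module ℂ U] [Module ℂ V] [Module ℂ W]

/-- The super braiding of two vector spaces with operators `p` and `q`. -/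
def swapL (p : U →ₗ[ℂ] U) (q : V →ₗ[ℂ] V) : U ⊗[ℂ] V →ₗ[ℂ] V ⊗[ℂ] U :=
  (TensorProduct.comm ℂ U V).toLinearMap ∘ₗ ((2⁻¹ : ℂ) •
    (LinearMap.id + LinearMap.rTensor V p + LinearMap.lTensor U q - TensorProduct.map p q))

lemma swapL_tmul (p : U →ₗ[ℂ] U) (q : V →ₗ[ℂ] V) (x : U) (y : V) :
    swapL p q (x ⊗ₜ y) =
      (2⁻¹ : ℂ) • (y ⊗ₜ x + y ⊗ₜ p x + q y ⊗ₜ x - q y ⊗ₜ p x) := by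
  simp [swapL]

lemma swapL_forward (p : U →ₗ[ℂ] U) (q : V →ₗ[ℂ] V) (r : W →ₗ[ℂ] W)
    (hp : ∀ x, p (p x) = x) :
    (TensorProduct.assoc ℂ V W U).toLinearMap ∘ₗ swapL p (TensorProduct.map q r) ∘ₗ
        (TensorProduct.assoc ℂ U V W).toLinearMap =
      LinearMap.lTensor V (swapL p r) ∘ₗ (TensorProduct.assoc ℂ V U W).toLinearMap ∘ₗ
        LinearMap.rTensor W (swapL p q) := by
  apply TensorProduct.ext_threefold
  intro x y z
  simp [swapL_tmul, hp, add_tmul, sub_tmul, tmul_add, tmul_sub, ← smul_tmul']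
  module

lemma swapL_reverse (p : U →ₗ[ℂ] U) (q : V →ₗ[ℂ] V) (r : W →ₗ[ℂ] W)
    (hr : ∀ x, r (r x) = x) :
    (TensorProduct.assoc ℂ W U V).symm.toLinearMap ∘ₗ swapL (TensorProduct.map p q) r ∘ₗ
        (TensorProduct.assoc ℂ U V W).symm.toLinearMap =
      LinearMap.rTensor V (swapL p r) ∘ₗ (TensorProduct.assoc ℂ U W V).symm.toLinearMap ∘ₗ
        LinearMap.lTensor U (swapL q r) := by
  apply TensorProduct.ext
  ext x : 1
  apply TensorProduct.ext'
  intro y z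
  simp [swapL_tmul, hr, add_tmul, sub_tmul, tmul_add, tmul_sub, ← smul_tmul']
  module

end LinearAlgebra

/-- The action of the generator as a linear map. -/
def parityL (V : RepZ2) : V.V →ₗ[ℂ] V.V := V.ρ (Multiplicative.ofAdd 1)

lemma parityL_parityL (V : RepZ2) (x : V.V) : parityL V (parityL V x) = x :=
  congrArg (fun f : V ⟶ V => f.hom.hom.hom x) (parity_sq V)

lemma superSwap_hom (V W : RepZ2) :
    (superSwap V W).hom.hom.hom.hom = swapL (parityL V) (parityL W) := by
  apply TensorProduct.ext'
  intro x y
  rfl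

lemma associator_hom_linear (U V W : RepZ2) : (α_ U V W).hom.hom.hom.hom =
    (TensorProduct.assoc ℂ U.V V.V W.V).toLinearMap := by
  rw [Action.associator_hom_hom]
  rfl

lemma associator_inv_linear (U V W : RepZ2) : (α_ U V W).inv.hom.hom.hom =
    (TensorProduct.assoc ℂ U.V V.V W.V).symm.toLinearMap := by
  rw [Action.associator_inv_hom]
  rfl

lemma whiskerLeft_linear (U : RepZ2) {V W : RepZ2} (f : V ⟶ W) :
    (U ◁ f).hom.hom.hom = LinearMap.lTensor U.V f.hom.hom.hom := rfl

lemma whiskerRight_linear (U : RepZ2) {V W : RepZ2} (f : V ⟶ W) :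
    (f ▷ U).hom.hom.hom = LinearMap.rTensor U.V f.hom.hom.hom := rfl

lemma comp_linear {U V W : RepZ2} (f : U ⟶ V) (g : V ⟶ W) :
    (f ≫ g).hom.hom.hom = g.hom.hom.hom ∘ₗ f.hom.hom.hom := rfl

/-- The super braiding on the monoidal category of representations of `ℤ/2ℤ`. -/
@[reducible]
def superBraiding : BraidedCategory RepZ2 where
  braiding := superSwap
  braiding_naturality_right X Y Z f := by
    simp [superSwap, reassoc_of% sgn_naturality_right]
  braiding_naturality_left f Z := by
    simp [superSwap, reassoc_of% sgn_naturality_left]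
  hexagon_forward U V W := by
    ext1
    apply ObjectProperty.hom_ext
    apply ModuleCat.hom_ext
    simp only [comp_linear, whiskerLeft_linear, whiskerRight_linear, associator_hom_linear,
      superSwap_hom]
    exact swapL_forward (parityL U) (parityL V) (parityL W) (parityL_parityL U)
  hexagon_reverse U V W := by
    ext1
    apply ObjectProperty.hom_ext
    apply ModuleCat.hom_ext
    simp only [comp_linear, whiskerLeft_linear, whiskerRight_linear, associator_inv_linear,
      superSwap_hom]
    exact swapL_reverse (parityL U) (parityL V) (parityL W) (parityL_parityL W)

end RepZ2

/-- The category of super vector spaces: the monoidal category of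
finite-dimensional representations of `ℤ/2ℤ`, with the super braiding
(and not the ordinary one, which is why this is not an `abbrev`). -/
def SVec : Type 1 := RepZ2

namespace SVec

instance : Category.{0} SVec := inferInstanceAs (Category RepZ2)
instance : Preadditive SVec := inferInstanceAs (Preadditive RepZ2)
instance : Linear ℂ SVec := inferInstanceAs (Linear ℂ RepZ2)
instance : MonoidalCategory SVec := inferInstanceAs (MonoidalCategory RepZ2)
instance : BraidedCategory SVec := RepZ2.superBraiding

end SVec

/-- Slightly degenerate: the Müger centre is braided equivalent to super vector spaces. -/
def IsSlightlyDegenerate (B : Type u) [Category.{v} B] [Preadditive B] [Linear ℂ B]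
    [MonoidalCategory B] [BraidedCategory B] : Prop :=
  BraidedEquivalent (MugerCenter B) SVec

/-- Non-degenerate: the Müger centre is braided equivalent to
finite-dimensional vector spaces. -/
def IsNondegenerate (B : Type u) [Category.{v} B] [Preadditive B] [Linear ℂ B]
    [MonoidalCategory B] [BraidedCategory B] : Prop :=
  BraidedEquivalent (MugerCenter B) (FGModuleCat.{0} ℂ)

/-! ### Spherical structures and modular categories -/

section Spherical

variable (C : Type u) [Category.{v} C] [MonoidalCategory C] [RigidCategory C]

variable {C} in
/-- The (chosen right) dual `X*`, with evaluation `X* ⊗ X ⟶ 1` and coevaluation `1 ⟶ X ⊗ X*`. -/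
abbrev dual (X : C) : C := HasRightDual.rightDual X

variable {C} in
/-- The canonical isomorphism `X** ⊗ Y** ≅ (X ⊗ Y)**`, as a morphism. -/
def doubleDualTensor (X Y : C) : dual (dual X) ⊗ dual (dual Y) ⟶ dual (dual (X ⊗ Y)) :=
  (rightDualTensorIso (dual Y) (dual X)).inv ≫ rightAdjointMate (rightDualTensorIso X Y).hom

/-- A pivotal structure: a monoidal natural isomorphism from the identity to the double dual
(compatibility with the unit follows from compatibility with tensor products). -/
structure PivotalStructure where
  iso : ∀ X : C, X ≅ dual (dual X)
  naturality : ∀ {X Y : C} (f : X ⟶ Y),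
    f ≫ (iso Y).hom = (iso X).hom ≫ rightAdjointMate (rightAdjointMate f)
  tensor : ∀ X Y : C,
    ((iso X).hom ⊗ₘ (iso Y).hom) ≫ doubleDualTensor X Y = (iso (X ⊗ Y)).hom

variable {C}

/-- The trace `1 ⟶ X ⊗ X* ⟶ X** ⊗ X* ⟶ 1` of an endomorphism of `X`. -/
def PivotalStructure.leftTrace (φ : PivotalStructure C) {X : C} (f : X ⟶ X) : 𝟙_ C ⟶ 𝟙_ C :=
  η_ X (dual X) ≫ (f ≫ (φ.iso X).hom) ▷ (dual X) ≫ ε_ (dual X) (dual (dual X))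

/-- The trace `1 ⟶ X* ⊗ X** ⟶ X* ⊗ X ⟶ 1` of an endomorphism of `X`. -/
def PivotalStructure.rightTrace (φ : PivotalStructure C) {X : C} (f : X ⟶ X) : 𝟙_ C ⟶ 𝟙_ C :=
  η_ (dual X) (dual (dual X)) ≫ (dual X) ◁ ((φ.iso X).inv ≫ f) ≫ ε_ X (dual X)

variable (C) in
/-- A spherical structure: a pivotal structure whose two traces agree. -/
structure SphericalStructure extends PivotalStructure C where
  spherical : ∀ {X : C} (f : X ⟶ X),
    toPivotalStructure.leftTrace f = toPivotalStructure.rightTrace f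

end Spherical

/-- A modular category: a non-degenerate braided fusion category admitting a
spherical structure. -/
structure IsModular (C : Type u) [Category.{v} C] [Abelian C] [Linear ℂ C]
    [MonoidalCategory C] [MonoidalPreadditive C] [MonoidalLinear ℂ C] [RigidCategory C]
    [BraidedCategory C] : Prop where
  isFusion : IsFusion C
  spherical : Nonempty (SphericalStructure C)
  nondegenerate : IsNondegenerate C

/-- A minimal modular extension of `B`: a modular category `M` with a fully faithful braided
`ℂ`-linear functor `B ⥤ M`, such that `FPdim M = FPdim B * FPdim (Z₂ B)`. -/
structure MinimalModularExtension (B : Type u) [Category.{v} B] [Abelian B] [Linear ℂ B]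
    [MonoidalCategory B] [BraidedCategory B] where
  M : Type u
  [category : Category.{v} M]
  [abelian : Abelian M]
  [linear : Linear ℂ M]
  [monoidal : MonoidalCategory M]
  [monoidalPreadditive : MonoidalPreadditive M]
  [monoidalLinear : MonoidalLinear ℂ M]
  [rigid : RigidCategory M]
  [braided : BraidedCategory M]
  modular : IsModular M
  embedding : B ⥤ M
  [embedding_braided : embedding.Braided]
  embedding_additive : embedding.Additive
  embedding_linear : embedding.Linear ℂ
  embedding_full : embedding.Full
  embedding_faithful : embedding.Faithful
  FPdim_eq : FPdim M = FPdim B * FPdim (MugerCenter B)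

end FusionCat

end

noncomputable section

namespace FusionCat

/-! ### Semisimple decompositions -/

section Semisimple

/-! Let `G` be the finite abelian group of classes of simple objects of `B`. The Müger centre has
exactly two simple objects, the unit and a fermion `f`, and the self-braiding of `f` is `-1`
(`exists_fermion`). The class of `f` is not a square in `G`: if `f ≅ S ⊗ S` and `S` has
self-braiding `q`, then the self-braiding of `f` and the double braiding of `S` with `f` are both `q
^ 4`, but the former is `-1` and the latter is `1` (`not_square_of_braiding_eq_neg`). So `f`
survives in `G / G²`, and there is a character `χ` of `G` with values `±1` and `χ f = -1`
(`exists_quadratic_character`). Letting `χ` act on simple objects gives a monoidal involution `θ` of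
the identity functor (`exists_monoidal_involution`).

The extension is the product of `Rep(ℤ/2)` with `B`, realised as objects of `B` with an involution.
Its simple objects are pairs `(ε, S)` of a sign and a simple object of `B`. The tensor product is
the usual one, and the braiding of `(ε, S)` with `(δ, T)` is that of `B`, multiplied by `χ T` when
`ε = -1`. This factor is a bicharacter, so the hexagons survive (`twistedBraiding`), and `B` embeds
as the pairs with `ε = 1`.

If `(ε, S)` is transparent, its double braiding with `(-1, 𝟙)` gives `χ S = 1`, and its double
braiding with `(1, f)`, where `f` is transparent and `χ f = -1`, gives `ε = 1`. Then `S` is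
transparent in `B`, and it is not `f` because `χ f = -1`; hence it is the unit
(`TwistedAction.nonempty_iso_unit_of_isTransparent`).

Pointed fusion categories have dimension the number of their simple objects, so the dimension
condition reads `2 |G| = |G| * 2`. Three general facts complete the argument. A pointed fusion
category is spherical, by normalising `X ⟶ X**` on invertible objects so that the identity has trace
`1` (`nonempty_sphericalStructure`). A braided category whose objects are sums of the unit is
equivalent to vector spaces (`IsUnitGenerated.braidedEquivalent`). The construction can be
transported to a type of objects in the universe of `B`
(`nonempty_minimalModularExtension_of_functor`). -/

/-- `X` is a finite direct sum of objects satisfying `P`. -/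
def IsSumOf {C : Type u} [Category.{v} C] [Preadditive C] (P : C → Prop) (X : C) : Prop :=
  ∃ (J : Type) (_ : Fintype J) (_ : DecidableEq J) (S : J → C)
    (i : ∀ k, S k ⟶ X) (p : ∀ k, X ⟶ S k),
    (∀ k, P (S k)) ∧ (∀ k l, i k ≫ p l = if h : k = l then eqToHom (by rw [h]) else 0) ∧
      ∑ k, p k ≫ i k = 𝟙 X

variable {C : Type u} [Category.{v} C]

lemma IsSumOf.of_biproduct [Preadditive C] [HasFiniteBiproducts C] {P : C → Prop} {X : C} {n : ℕ}
    {S : Fin n → C} (hS : ∀ k, P (S k)) (e : X ≅ ⨁ S) : IsSumOf P X := by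
  refine ⟨Fin n, inferInstance, inferInstance, S, fun k => biproduct.ι S k ≫ e.inv,
    fun k => e.hom ≫ biproduct.π S k, hS, fun k l => ?_, ?_⟩
  · simp [biproduct.ι_π]
  · have h : e.hom ≫ (∑ k, biproduct.π S k ≫ biproduct.ι S k) ≫ e.inv = 𝟙 X := by
      rw [biproduct.total]; simp
    rw [← h, Preadditive.sum_comp, Preadditive.comp_sum]
    simp

lemma IsSumOf.exists_biproduct [Preadditive C] [HasFiniteBiproducts C] {P : C → Prop} {X : C}
    (h : IsSumOf P X) : ∃ (n : ℕ) (S : Fin n → C), (∀ k, P (S k)) ∧ Nonempty (X ≅ ⨁ S) := by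
  obtain ⟨J, _, _, S, i, p, hP, horth, htot⟩ := h
  let e := (Fintype.equivFin J).symm
  refine ⟨Fintype.card J, fun k => S (e k), fun k => hP _, ⟨?_⟩⟩
  refine ⟨biproduct.lift fun k => p (e k), biproduct.desc fun k => i (e k), ?_, ?_⟩
  · rw [biproduct.lift_desc, ← htot]
    exact e.sum_comp fun k => p k ≫ i k
  · ext k l
    simp only [Category.assoc, biproduct.lift_π, biproduct.ι_desc_assoc, horth]
    rw [Category.id_comp, biproduct.ι_π]
    by_cases h : l = k
    · subst h; simp
    · simp [h]

lemma IsSumOf.of_iso [Preadditive C] {P : C → Prop} {X Y : C} (h : IsSumOf P X) (e : X ≅ Y) :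
    IsSumOf P Y := by
  obtain ⟨J, _, _, S, i, p, hP, horth, htot⟩ := h
  refine ⟨J, inferInstance, inferInstance, S, fun k => i k ≫ e.hom, fun k => e.inv ≫ p k, hP,
    fun k l => by simp [horth], ?_⟩
  have h : e.inv ≫ (∑ k, p k ≫ i k) ≫ e.hom = 𝟙 Y := by rw [htot]; simp
  rw [← h, Preadditive.sum_comp, Preadditive.comp_sum]
  simp

lemma IsSumOf.map [Preadditive C] {D : Type u'} [Category.{v'} D] [Preadditive D]
    {P : C → Prop} {Q : D → Prop} {X : C} (h : IsSumOf P X) (F : C ⥤ D) [F.Additive]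
    (hF : ∀ S, P S → Q (F.obj S)) : IsSumOf Q (F.obj X) := by
  obtain ⟨J, _, _, S, i, p, hP, horth, htot⟩ := h
  refine ⟨J, inferInstance, inferInstance, fun k => F.obj (S k), fun k => F.map (i k),
    fun k => F.map (p k), fun k => hF _ (hP k), fun k l => ?_, ?_⟩
  · rw [← F.map_comp, horth]
    split_ifs with h
    · subst h; simp
    · simp
  · simp_rw [← F.map_comp]
    rw [← F.map_sum, htot, F.map_id]

lemma IsSumOf.trans [Preadditive C] {P Q : C → Prop} {X : C} (h : IsSumOf P X)
    (hPQ : ∀ S, P S → IsSumOf Q S) : IsSumOf Q X := by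
  obtain ⟨J, _, _, S, i, p, hP, horth, htot⟩ := h
  choose K _ _ T j q hQ horth' htot' using fun k => hPQ _ (hP k)
  refine ⟨Σ k, K k, inferInstance, inferInstance, fun a => T a.1 a.2, fun a => j a.1 a.2 ≫ i a.1,
    fun a => p a.1 ≫ q a.1 a.2, fun a => hQ _ _, ?_, ?_⟩
  · rintro ⟨k, a⟩ ⟨l, b⟩
    by_cases h : k = l
    · subst h
      simp only [Category.assoc, reassoc_of% horth, dite_true, eqToHom_refl, Category.id_comp,
        horth']
      by_cases hab : a = b
      · subst hab; simp
      · simp [hab]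
    · simp [reassoc_of% horth, h]
  · rw [Fintype.sum_sigma]
    simp only [Category.assoc]
    rw [← htot]
    refine Finset.sum_congr rfl fun k _ => ?_
    have := congrArg (fun f => p k ≫ f ≫ i k) (htot' k)
    simpa [Preadditive.sum_comp, Preadditive.comp_sum] using this

/-- A semisimple object, in terms of inclusions and projections. -/
lemma isSumOf_simple [Abelian C] [Linear ℂ C] [MonoidalCategory C]
    [MonoidalPreadditive C] [MonoidalLinear ℂ C] [RigidCategory C] [IsFusion C] (X : C) :
    IsSumOf (fun S : C => Simple S) X := by
  obtain ⟨n, S, hS, ⟨e⟩⟩ := IsFusion.semisimple X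
  have := Abelian.hasFiniteBiproducts (C := C)
  exact IsSumOf.of_biproduct hS e

lemma IsSumOf.exists_total [Preadditive C] {P : C → Prop} {X : C} (h : IsSumOf P X) :
    ∃ (J : Type) (_ : Fintype J) (S : J → C) (i : ∀ k, S k ⟶ X) (p : ∀ k, X ⟶ S k),
      (∀ k, P (S k)) ∧ ∑ k, p k ≫ i k = 𝟙 X := by
  obtain ⟨J, _, _, S, i, p, hP, -, htot⟩ := h
  exact ⟨J, inferInstance, S, i, p, hP, htot⟩

/-! ### Extending natural transformations from summands to all objects. -/

section Extension

variable [Preadditive C] {D : Type u'} [Category.{v'} D] [Preadditive D]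
  {P : C → Prop}

/-- Natural transformations of additive functors agree if they agree on summands. -/
lemma natTrans_ext_of_isSumOf (hC : ∀ X : C, IsSumOf P X) {F G : C ⥤ D} [F.Additive]
    {α β : F ⟶ G} (h : ∀ S, P S → α.app S = β.app S) : α = β := by
  ext X
  obtain ⟨J, _, S, i, p, hP, htot⟩ := (hC X).exists_total
  rw [← Category.id_comp (α.app X), ← Category.id_comp (β.app X), ← F.map_id, ← htot, F.map_sum,
    Preadditive.sum_comp, Preadditive.sum_comp]
  refine Finset.sum_congr rfl fun k _ => ?_
  simp only [F.map_comp, Category.assoc, NatTrans.naturality, h _ (hP k)]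

/-- A family of morphisms natural on the summands extends to a natural transformation. -/
lemma exists_natTrans_of_isSumOf (hC : ∀ X : C, IsSumOf P X) {F G : C ⥤ D} [F.Additive]
    [G.Additive] (a : ∀ S, P S → (F.obj S ⟶ G.obj S))
    (ha : ∀ S T (hS : P S) (hT : P T) (f : S ⟶ T), F.map f ≫ a T hT = a S hS ≫ G.map f) :
    ∃ α : F ⟶ G, ∀ S hS, α.app S = a S hS := by
  choose J _ S i p hP htot using fun X => (hC X).exists_total
  -- The formula uses a chosen decomposition of each object. Naturality follows by expanding `f`
  -- into its matrix entries `i ≫ f ≫ p` between summands, to which `ha` applies.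
  let b : ∀ X, F.obj X ⟶ G.obj X := fun X => ∑ k, F.map (p X k) ≫ a _ (hP X k) ≫ G.map (i X k)
  have hb : ∀ {X Y} (f : X ⟶ Y), F.map f ≫ b Y = b X ≫ G.map f := by
    intro X Y f
    have h1 : F.map f ≫ b Y = ∑ k, ∑ l, F.map (p X k ≫ i X k ≫ f ≫ p Y l) ≫ a _ (hP Y l) ≫
        G.map (i Y l) := by
      rw [Finset.sum_comm, Preadditive.comp_sum]
      refine Finset.sum_congr rfl fun l _ => ?_
      rw [← Category.assoc, ← F.map_comp, ← Preadditive.sum_comp, ← F.map_sum]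
      congr 2
      refine (Category.id_comp _).symm.trans ?_
      rw [← htot X, Preadditive.sum_comp]
      simp only [Category.assoc]
    have h2 : b X ≫ G.map f = ∑ k, ∑ l, F.map (p X k) ≫ a _ (hP X k) ≫
        G.map (i X k ≫ f ≫ p Y l ≫ i Y l) := by
      rw [Preadditive.sum_comp]
      refine Finset.sum_congr rfl fun k _ => ?_
      rw [← Preadditive.comp_sum, ← Preadditive.comp_sum, ← G.map_sum, ← Preadditive.comp_sum,
        ← Preadditive.comp_sum, htot]
      simp
    rw [h1, h2]
    refine Finset.sum_congr rfl fun k _ => Finset.sum_congr rfl fun l _ => ?_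
    rw [F.map_comp, Category.assoc, ← Category.assoc (F.map (i X k ≫ f ≫ p Y l)),
      ha _ _ (hP X k) (hP Y l), Category.assoc, ← G.map_comp]
    simp
  refine ⟨⟨b, fun X Y f => hb f⟩, fun T hT => ?_⟩
  change ∑ k, F.map (p T k) ≫ a _ (hP T k) ≫ G.map (i T k) = _
  simp_rw [← ha _ _ (hP T _) hT, ← Category.assoc, ← F.map_comp]
  rw [← Preadditive.sum_comp, ← F.map_sum, htot, F.map_id, Category.id_comp]

end Extension

section Schur

variable [Abelian C] [Linear ℂ C]

lemma exists_smul_id {X : C} [Simple X] [FiniteDimensional ℂ (X ⟶ X)] (f : X ⟶ X) :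
    ∃ c : ℂ, f = c • 𝟙 X := by
  obtain ⟨c, hc⟩ := endomorphism_simple_eq_smul_id ℂ f
  exact ⟨c, hc.symm⟩

end Schur

end Semisimple

/-! ### Isomorphism classes of simple objects -/

section Irr

variable {C : Type u} [Category.{v} C] [Preadditive C]

instance Irr.simple_rep (i : Irr C) : Simple i.rep := (Quotient.out i).2

/-- The isomorphism class of a simple object. -/
def Irr.of (X : C) [hX : Simple X] : Irr C := Quotient.mk (simpleSetoid C) ⟨X, hX⟩

lemma Irr.of_eq_of_iff {X Y : C} [Simple X] [Simple Y] :
    Irr.of X = Irr.of Y ↔ Nonempty (X ≅ Y) :=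
  Quotient.eq (r := simpleSetoid C)

lemma Irr.of_eq {X Y : C} [Simple X] [Simple Y] (e : X ≅ Y) : Irr.of X = Irr.of Y :=
  Irr.of_eq_of_iff.2 ⟨e⟩

@[simp]
lemma Irr.of_rep (i : Irr C) : Irr.of i.rep = i :=
  Quotient.out_eq (s := simpleSetoid C) i

lemma Irr.nonempty_rep_of_iso (X : C) [Simple X] : Nonempty ((Irr.of X).rep ≅ X) :=
  Irr.of_eq_of_iff.1 (Irr.of_rep _)

lemma Irr.eq_iff {i j : Irr C} : i = j ↔ Nonempty (i.rep ≅ j.rep) := by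
  rw [← Irr.of_eq_of_iff, Irr.of_rep, Irr.of_rep]

end Irr

/-! ### Frobenius-Perron dimensions of pointed categories -/

section FPdim

open Classical in
/-- If the tensor product by each simple object permutes the simple objects, then the
Frobenius-Perron dimension is the number of simple objects. -/
lemma FPdim_eq_card {C : Type u} [Category.{v} C] [Preadditive C] [Linear ℂ C]
    [MonoidalCategory C] [Finite (Irr C)]
    (hSchur : ∀ i j : Irr C, Module.finrank ℂ (i.rep ⟶ j.rep) = if i = j then 1 else 0)
    (m : Irr C → Equiv.Perm (Irr C)) (hm : ∀ i j, Nonempty (i.rep ⊗ j.rep ≅ (m i j).rep)) :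
    FPdim C = Nat.card (Irr C) := by
  have := Fintype.ofFinite (Irr C)
  have hmult : ∀ k i j : Irr C, fusionMult k.rep i j = if j = m k i then 1 else 0 := by
    intro k i j
    obtain ⟨e⟩ := hm k i
    rw [fusionMult, ← hSchur]
    exact LinearEquiv.finrank_eq (Linear.homCongr ℂ (Iso.refl _) e)
  have hdim : ∀ k : Irr C, objFPdim k.rep = 1 := by
    intro k
    have hset : {r : ℝ | 0 ≤ r ∧ ∃ w : Irr C → ℝ, w ≠ 0 ∧
        ∀ j : Irr C, ∑ᶠ i : Irr C, (fusionMult k.rep i j : ℝ) * w i = r * w j} = {1} := by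
      -- Multiplication by `k` is a permutation matrix, so the eigenvalue equation becomes `w i = r
      -- * w (m k i)`.
      have hsum : ∀ (w : Irr C → ℝ) (i : Irr C),
          ∑ᶠ i' : Irr C, (fusionMult k.rep i' (m k i) : ℝ) * w i' = w i := by
        intro w i
        rw [finsum_eq_sum_of_fintype]
        simp [hmult, (m k).injective.eq_iff]
      ext r
      simp only [Set.mem_ofPred_eq, Set.mem_singleton_iff]
      constructor
      · rintro ⟨hr, w, hw, h⟩
        have h' : ∀ i, w i = r * w (m k i) := fun i => by rw [← h, hsum]
        -- A permutation preserves the sum of squares, which forces `r ^ 2 = 1`; with `0 ≤ r` this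
        -- leaves `r = 1`.
        have hsq : ∑ i, w i ^ 2 = r ^ 2 * ∑ i, w i ^ 2 := by
          conv_lhs => enter [2, i]; rw [h', mul_pow]
          rw [← Finset.mul_sum, Equiv.sum_comp (m k) fun i => w i ^ 2]
        have hpos : 0 < ∑ i, w i ^ 2 := by
          obtain ⟨i, hi⟩ := Function.ne_iff.1 hw
          exact Finset.sum_pos' (fun _ _ => sq_nonneg _) ⟨i, Finset.mem_univ _, by
            have : w i ≠ 0 := hi
            positivity⟩
        have : r ^ 2 = 1 := by
          have := mul_right_cancel₀ hpos.ne' ((one_mul _).trans hsq)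
          exact this.symm
        nlinarith
      · rintro rfl
        refine ⟨zero_le_one, fun _ => 1, fun h => one_ne_zero (congrFun h k), fun j => ?_⟩
        obtain ⟨i, rfl⟩ := (m k).surjective j
        rw [hsum]; simp
    rw [objFPdim, hset, csSup_singleton]
  rw [FPdim, finsum_eq_sum_of_fintype]
  simp [hdim]

end FPdim

/-! ### Invertible objects -/

section Invertible

variable {C : Type u} [Category.{v} C] [MonoidalCategory C]

lemma IsInvertibleObj.of_iso {X Y : C} (h : IsInvertibleObj X) (e : X ≅ Y) :
    IsInvertibleObj Y := by
  obtain ⟨Z, ⟨a⟩, ⟨b⟩⟩ := h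
  exact ⟨Z, ⟨whiskerRightIso e.symm Z ≪≫ a⟩, ⟨whiskerLeftIso Z e.symm ≪≫ b⟩⟩

/-- Tensoring with an invertible object is an equivalence. -/
lemma IsInvertibleObj.isEquivalence_tensorLeft {X : C} (h : IsInvertibleObj X) :
    (tensorLeft X).IsEquivalence := by
  obtain ⟨Y, ⟨a⟩, ⟨b⟩⟩ := h
  have key : ∀ {X Y : C} (b : Y ⊗ X ≅ 𝟙_ C), Nonempty (tensorLeft X ⋙ tensorLeft Y ≅ 𝟭 C) :=
    fun {X Y} b => ⟨(tensorLeftTensor Y X).symm ≪≫ (tensoringLeft C).mapIso b ≪≫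
      leftUnitorNatIso C⟩
  obtain ⟨u⟩ := key b
  obtain ⟨w⟩ := key a
  exact (CategoryTheory.Equivalence.mk (tensorLeft X) (tensorLeft Y) u.symm w).isEquivalence_functor

lemma IsInvertibleObj.simple_tensor [Preadditive C] {X : C} (h : IsInvertibleObj X) (Y : C)
    [Simple Y] : Simple (X ⊗ Y) := by
  have := h.isEquivalence_tensorLeft
  exact simple_obj (tensorLeft X) Y

lemma IsInvertibleObj.cancel_left {X Y Z : C} (h : IsInvertibleObj X) (e : X ⊗ Y ≅ X ⊗ Z) :
    Nonempty (Y ≅ Z) := by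
  have := h.isEquivalence_tensorLeft
  exact ⟨(tensorLeft X).preimageIso e⟩

end Invertible

/-! ### Pointed fusion categories and the group of their simple classes. -/

section Fusion

variable {C : Type u} [Category.{v} C] [Abelian C] [Linear ℂ C] [MonoidalCategory C]
  [MonoidalPreadditive C] [MonoidalLinear ℂ C] [RigidCategory C] [IsFusion C]

instance IsFusion.finiteDimensional (X Y : C) : FiniteDimensional ℂ (X ⟶ Y) :=
  IsFusion.finiteDimensional_hom X Y

instance IsFusion.simple_tensorUnit : Simple (𝟙_ C) := IsFusion.simple_unit

instance IsFusion.finite_Irr : Finite (Irr C) := IsFusion.finite_irr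

open Classical in
lemma finrank_hom_rep (i j : Irr C) :
    Module.finrank ℂ (i.rep ⟶ j.rep) = if i = j then 1 else 0 := by
  rw [finrank_hom_simple_simple ℂ i.rep j.rep]
  simp only [Irr.eq_iff]

/-- Pointed fusion categories have Frobenius-Perron dimension the number of simple objects. -/
lemma FPdim_eq_card_of_isPointed (h : IsPointed C) : FPdim C = Nat.card (Irr C) := by
  have hs : ∀ i j : Irr C, Simple (i.rep ⊗ j.rep) := fun i j =>
    (h i.rep inferInstance).simple_tensor j.rep
  refine FPdim_eq_card finrank_hom_rep
    (fun i => Equiv.ofBijective (fun j => Irr.of (i.rep ⊗ j.rep))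
      (Finite.injective_iff_bijective.1 fun j k hjk => ?_)) fun i j => ?_
  · obtain ⟨e⟩ := Irr.of_eq_of_iff.1 hjk
    exact Irr.eq_iff.2 ((h i.rep inferInstance).cancel_left e)
  · obtain ⟨e⟩ := Irr.nonempty_rep_of_iso (i.rep ⊗ j.rep)
    exact ⟨e.symm⟩

/-- The group of isomorphism classes of simple objects of a pointed braided fusion category. -/
@[reducible]
def irrCommGroup [BraidedCategory C] (h : IsPointed C) : CommGroup (Irr C) :=
  letI hs (i j : Irr C) : Simple (i.rep ⊗ j.rep) := (h i.rep inferInstance).simple_tensor j.rep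
  have hinv (i : Irr C) : ∃ j : Irr C, Nonempty (j.rep ⊗ i.rep ≅ 𝟙_ C) := by
    obtain ⟨Y, ⟨a⟩, ⟨b⟩⟩ := h i.rep inferInstance
    have : Simple (i.rep ⊗ Y) := Simple.of_iso a
    -- The inverse is itself simple, since tensoring with `i.rep` is an equivalence taking it to the
    -- unit up to isomorphism.
    have hY : Simple Y := by
      have := (h i.rep inferInstance).isEquivalence_tensorLeft
      exact (simple_obj_iff (tensorLeft i.rep) Y).1 ‹_›
    obtain ⟨e⟩ := Irr.nonempty_rep_of_iso Y
    exact ⟨Irr.of Y, ⟨whiskerRightIso e _ ≪≫ b⟩⟩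
  { mul i j := Irr.of (i.rep ⊗ j.rep)
    one := Irr.of (𝟙_ C)
    inv i := (hinv i).choose
    mul_assoc i j k := by
      obtain ⟨e⟩ := Irr.nonempty_rep_of_iso (i.rep ⊗ j.rep)
      obtain ⟨e'⟩ := Irr.nonempty_rep_of_iso (j.rep ⊗ k.rep)
      exact Irr.of_eq (whiskerRightIso e _ ≪≫ α_ _ _ _ ≪≫ whiskerLeftIso _ e'.symm)
    one_mul i := by
      obtain ⟨e⟩ := Irr.nonempty_rep_of_iso (𝟙_ C)
      exact (Irr.of_eq (whiskerRightIso e _ ≪≫ λ_ _)).trans (Irr.of_rep i)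
    mul_one i := by
      obtain ⟨e⟩ := Irr.nonempty_rep_of_iso (𝟙_ C)
      exact (Irr.of_eq (whiskerLeftIso _ e ≪≫ ρ_ _)).trans (Irr.of_rep i)
    inv_mul_cancel i := Irr.of_eq (hinv i).choose_spec.some
    mul_comm i j := Irr.of_eq (β_ i.rep j.rep) }

/-- The group law is defined through chosen representatives; this frees it from that choice. -/
lemma irrCommGroup_of_mul_of [BraidedCategory C] (h : IsPointed C) (X Y : C) [Simple X]
    [Simple Y] [Simple (X ⊗ Y)] :
    letI := irrCommGroup h
    Irr.of X * Irr.of Y = Irr.of (X ⊗ Y) := by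
  obtain ⟨e⟩ := Irr.nonempty_rep_of_iso X
  obtain ⟨e'⟩ := Irr.nonempty_rep_of_iso Y
  have := (h (Irr.of X).rep inferInstance).simple_tensor (Irr.of Y).rep
  exact Irr.of_eq (tensorIso e e')

end Fusion

/-! ### Quadratic characters and monoidal involutions of the identity functor -/

/-- The class of `f` in `G / G²` is nontrivial, so some character of this finite abelian group is
not `1` on it. All elements of `G / G²` square to `1`, so the values are signs and the value at `f`
must be `-1`. -/
lemma exists_quadratic_character {G : Type*} [CommGroup G] [Finite G] {f : G}
    (hf : ∀ s : G, s * s ≠ f) :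
    ∃ χ : G →* ℂˣ, (∀ g, χ g * χ g = 1) ∧ χ f = -1 := by
  let N : Subgroup G := (powMonoidHom 2 : G →* G).range
  have hne : (f : G ⧸ N) ≠ 1 := by
    rw [Ne, QuotientGroup.eq_one_iff]
    rintro ⟨s, hs⟩
    exact hf s (by rw [← hs]; simp [sq])
  obtain ⟨φ, hφ⟩ := CommGroup.exists_apply_ne_one_of_hasEnoughRootsOfUnity (G ⧸ N) ℂ hne
  have hsq : ∀ g : G, φ (g : G ⧸ N) * φ (g : G ⧸ N) = 1 := by
    intro g
    have hg : ((g * g : G) : G ⧸ N) = 1 := (QuotientGroup.eq_one_iff _).2 ⟨g, by simp [sq]⟩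
    rw [← map_mul, ← QuotientGroup.mk_mul, hg, map_one]
  refine ⟨φ.comp (QuotientGroup.mk' N), hsq, ?_⟩
  have h : ((φ (f : G ⧸ N) : ℂˣ) : ℂ) * φ (f : G ⧸ N) = 1 := by
    rw [← Units.val_mul, hsq, Units.val_one]
  rcases mul_self_eq_one_iff.1 h with h | h
  · exact absurd (Units.ext h) hφ
  · exact Units.ext (by simpa using h)

section

variable {C : Type u} [Category.{v} C] [Abelian C] [Linear ℂ C] [MonoidalCategory C]
  [MonoidalPreadditive C] [MonoidalLinear ℂ C] [RigidCategory C] [IsFusion C]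

/-- Natural transformations of functors of two variables, additive in each, agree if they
agree on simple objects. -/
lemma tensor_natural_ext {D : Type u'} [Category.{v'} D] [Preadditive D]
    {F G : C ⥤ C ⥤ D} [∀ X, (F.obj X).Additive] [∀ X, (F.flip.obj X).Additive]
    {α β : F ⟶ G}
    (h : ∀ (S T : C) [Simple S] [Simple T], (α.app S).app T = (β.app S).app T) : α = β := by
  ext X Y
  refine congrArg (fun γ => γ.app X) (natTrans_ext_of_isSumOf (isSumOf_simple (C := C))
    (F := F.flip.obj Y) (G := G.flip.obj Y) (α := ((flipFunctor _ _ _).map α).app Y)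
    (β := ((flipFunctor _ _ _).map β).app Y) fun S hS => ?_)
  exact congrArg (fun γ => γ.app Y) (natTrans_ext_of_isSumOf (isSumOf_simple (C := C))
    (α := α.app S) (β := β.app S) fun T hT => h S T)

/-- Scalars depending only on the isomorphism class are natural on simple objects, because a nonzero
morphism between simple objects is an isomorphism. -/
lemma exists_natTrans_of_irr (χ : Irr C → ℂ) :
    ∃ θ : 𝟭 C ⟶ 𝟭 C, ∀ (S : C) [Simple S], θ.app S = χ (Irr.of S) • 𝟙 S := by
  obtain ⟨θ, hθ⟩ := exists_natTrans_of_isSumOf (isSumOf_simple (C := C)) (F := 𝟭 C) (G := 𝟭 C)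
    (fun S (_ : Simple S) => χ (Irr.of S) • 𝟙 S) fun S T hS hT f => by
      by_cases hf : f = 0
      · simp [hf]
      · have := isIso_of_hom_simple hf
        rw [Irr.of_eq (asIso f)]
        simp
  exact ⟨θ, fun S _ => hθ S _⟩

/-- A character of the group of simple classes is a monoidal automorphism of the identity functor:
multiplicativity of `χ` is compatibility with `⊗` on simple objects, and both sides are additive in
each variable. -/
lemma exists_monoidal_involution [BraidedCategory C] (hpt : IsPointed C)
    (χ : letI := irrCommGroup hpt; Irr C →* ℂˣ) (hχ : ∀ g, χ g * χ g = 1) :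
    ∃ θ : 𝟭 C ⟶ 𝟭 C, (∀ (S : C) [Simple S], θ.app S = (χ (Irr.of S) : ℂ) • 𝟙 S) ∧
      (∀ X, θ.app X ≫ θ.app X = 𝟙 X) ∧ (∀ X Y, θ.app (X ⊗ Y) = θ.app X ⊗ₘ θ.app Y) := by
  let _ := irrCommGroup hpt
  obtain ⟨θ, hθ⟩ := exists_natTrans_of_irr (C := C) fun g => (χ g : ℂ)
  refine ⟨θ, hθ, fun X => ?_, fun X Y => ?_⟩
  · refine congrArg (fun γ => γ.app X) (natTrans_ext_of_isSumOf (isSumOf_simple (C := C))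
      (α := θ ≫ θ) (β := 𝟙 (𝟭 C)) fun S (_ : Simple S) => ?_)
    have h := congrArg Units.val (hχ (Irr.of S))
    rw [Units.val_mul, Units.val_one] at h
    simp [hθ, smul_smul, h]
  · let α : curriedTensor C ⟶ curriedTensor C :=
      { app X := { app Y := θ.app (X ⊗ Y)
                   naturality Y Y' f := θ.naturality (X ◁ f) }
        naturality X X' f := by ext Y; exact θ.naturality (f ▷ Y) }
    let β : curriedTensor C ⟶ curriedTensor C :=
      { app X := { app Y := θ.app X ⊗ₘ θ.app Y
                   naturality Y Y' f := by
                    have := θ.naturality f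
                    dsimp at this ⊢
                    rw [← id_tensorHom, tensorHom_comp_tensorHom, this, tensorHom_comp_tensorHom]
                    simp }
        naturality X X' f := by
          ext Y
          have := θ.naturality f
          dsimp at this ⊢
          rw [← tensorHom_id, tensorHom_comp_tensorHom, this, tensorHom_comp_tensorHom]
          simp }
    have : ∀ X, ((curriedTensor C).obj X).Additive := fun X =>
      inferInstanceAs (tensorLeft X).Additive
    have : ∀ X, ((curriedTensor C).flip.obj X).Additive := fun X =>
      inferInstanceAs (tensorRight X).Additive
    have hαβ : α = β := tensor_natural_ext fun S T _ _ => by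
      have := (hpt S inferInstance).simple_tensor T
      change θ.app (S ⊗ T) = θ.app S ⊗ₘ θ.app T
      rw [hθ, hθ, hθ, ← irrCommGroup_of_mul_of hpt, map_mul, Units.val_mul]
      simp [MonoidalCategory.tensorHom_def, MonoidalLinear.smul_whiskerRight, MonoidalLinear.whiskerLeft_smul,
        smul_smul, mul_comm]
    exact congrArg (fun γ => (γ.app X).app Y) hαβ

end

/-! ### Twisting a braiding by a pair of monoidal involutions of the identity functor -/

section SignOperator

variable {C : Type u} [Category.{v} C] [Preadditive C] [Linear ℂ C]

/-- For commuting involutions `a` and `b`, the operator which is the identity where `a = 1` and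
is `b` where `a = -1`. -/
def signOp {W : C} (a b : W ⟶ W) : W ⟶ W := (2⁻¹ : ℂ) • (𝟙 W + a + b - a ≫ b)

/-- Where `a = 1` both sides are the identity, and where `a = -1` both are `b ≫ c`. Together with
`signOp_comp_signOp'`, this is the bicharacter property from which the twisted hexagons follow. -/
lemma signOp_comp_signOp {W : C} {a b c : W ⟶ W} (ha : a ≫ a = 𝟙 W) (hab : a ≫ b = b ≫ a) :
    signOp a b ≫ signOp a c = signOp a (b ≫ c) := by
  have ha' {Z} (g : W ⟶ Z) : a ≫ a ≫ g = g := by rw [← Category.assoc, ha, Category.id_comp]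
  have hab' {Z} (g : W ⟶ Z) : b ≫ a ≫ g = a ≫ b ≫ g := by
    rw [← Category.assoc, ← hab, Category.assoc]
  simp only [signOp, Linear.smul_comp, Linear.comp_smul,
    Preadditive.add_comp, Preadditive.comp_add, Preadditive.sub_comp, Preadditive.comp_sub,
    Category.id_comp, Category.comp_id, Category.assoc, ha, ha', hab', ← hab]
  module

lemma signOp_comm {W : C} {a b : W ⟶ W} (hab : a ≫ b = b ≫ a) : signOp a b = signOp b a := by
  rw [signOp, signOp, hab]; congr 1; abel

lemma signOp_comp_signOp' {W : C} {a b c : W ⟶ W} (hc : c ≫ c = 𝟙 W) (hac : a ≫ c = c ≫ a)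
    (hbc : b ≫ c = c ≫ b) : signOp a c ≫ signOp b c = signOp (a ≫ b) c := by
  rw [signOp_comm hac, signOp_comm hbc, signOp_comp_signOp hc hac.symm, signOp_comm]
  rw [← Category.assoc, ← hac, Category.assoc, ← hbc, Category.assoc]

lemma signOp_sq {W : C} {a b : W ⟶ W} (ha : a ≫ a = 𝟙 W) (hb : b ≫ b = 𝟙 W)
    (hab : a ≫ b = b ≫ a) : signOp a b ≫ signOp a b = 𝟙 W := by
  rw [signOp_comp_signOp ha hab, hb, signOp, Category.comp_id]
  module

lemma signOp_naturality {W W' : C} {a b : W ⟶ W} {a' b' : W' ⟶ W'} {f : W ⟶ W'}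
    (ha : a ≫ f = f ≫ a') (hb : b ≫ f = f ≫ b') : signOp a b ≫ f = f ≫ signOp a' b' := by
  have hb' {Z} (g : W' ⟶ Z) : b ≫ f ≫ g = f ≫ b' ≫ g := by
    rw [← Category.assoc, hb, Category.assoc]
  have ha' {Z} (g : W' ⟶ Z) : a ≫ f ≫ g = f ≫ a' ≫ g := by
    rw [← Category.assoc, ha, Category.assoc]
  simp only [signOp, Linear.smul_comp, Linear.comp_smul,
    Preadditive.add_comp, Preadditive.comp_add, Preadditive.sub_comp, Preadditive.comp_sub,
    Category.id_comp, Category.comp_id, Category.assoc, ha, hb, ha']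

lemma signOp_id_left {W : C} (b : W ⟶ W) : signOp (𝟙 W) b = 𝟙 W := by
  rw [signOp, Category.id_comp]; module

lemma signOp_id_right {W : C} (a : W ⟶ W) : signOp a (𝟙 W) = 𝟙 W := by
  rw [signOp, Category.comp_id]; module

lemma signOp_neg_id_left {W : C} (b : W ⟶ W) : signOp (-𝟙 W) b = b := by
  rw [signOp, Preadditive.neg_comp, Category.id_comp]; module

lemma map_signOp {D : Type u'} [Category.{v'} D] [Preadditive D] [Linear ℂ D] (F : C ⥤ D)
    [F.Additive] [F.Linear ℂ] {W : C} (a b : W ⟶ W) :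
    F.map (signOp a b) = signOp (F.map a) (F.map b) := by
  simp [signOp, F.map_smul, F.map_sub]

end SignOperator

section Twist

/-- A monoidal involution of the identity functor. -/
structure MonoidalInvolution (C : Type u) [Category.{v} C] [MonoidalCategory C] where
  toNatTrans : 𝟭 C ⟶ 𝟭 C
  sq : ∀ X, toNatTrans.app X ≫ toNatTrans.app X = 𝟙 X
  tensor : ∀ X Y, toNatTrans.app (X ⊗ Y) = toNatTrans.app X ⊗ₘ toNatTrans.app Y

variable {C : Type u} [Category.{v} C] [MonoidalCategory C]

/-- The component of a monoidal involution. -/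
def MonoidalInvolution.at (s : MonoidalInvolution C) (X : C) : X ⟶ X := s.toNatTrans.app X

variable (s θ : MonoidalInvolution C)

lemma MonoidalInvolution.at_comp {X Y : C} (f : X ⟶ Y) : s.at X ≫ f = f ≫ s.at Y :=
  (s.toNatTrans.naturality f).symm

lemma MonoidalInvolution.at_sq (X : C) : s.at X ≫ s.at X = 𝟙 X := s.sq X

lemma MonoidalInvolution.at_tensor (X Y : C) : s.at (X ⊗ Y) = s.at X ▷ Y ≫ X ◁ s.at Y := by
  rw [← MonoidalCategory.tensorHom_def]; exact s.tensor X Y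

variable [Preadditive C] [Linear ℂ C]

/-- The operator on `X ⊗ Y` by which the braiding is twisted. -/
def twistOp (X Y : C) : X ⊗ Y ⟶ X ⊗ Y := signOp (s.at X ▷ Y) (X ◁ θ.at Y)

lemma twistOp_sq (X Y : C) : twistOp s θ X Y ≫ twistOp s θ X Y = 𝟙 _ := by
  refine signOp_sq ?_ ?_ (whisker_exchange _ _).symm
  · rw [← comp_whiskerRight, s.at_sq, id_whiskerRight]
  · rw [← MonoidalCategory.whiskerLeft_comp, θ.at_sq, MonoidalCategory.whiskerLeft_id]

lemma twistOp_whiskerRight {X X' : C} (f : X ⟶ X') (Y : C) :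
    twistOp s θ X Y ≫ f ▷ Y = f ▷ Y ≫ twistOp s θ X' Y := by
  refine signOp_naturality ?_ (whisker_exchange _ _)
  rw [← comp_whiskerRight, ← comp_whiskerRight, s.at_comp]

lemma twistOp_whiskerLeft {Y Y' : C} (f : Y ⟶ Y') (X : C) :
    twistOp s θ X Y ≫ X ◁ f = X ◁ f ≫ twistOp s θ X Y' := by
  refine signOp_naturality (whisker_exchange _ _).symm ?_
  rw [← MonoidalCategory.whiskerLeft_comp, ← MonoidalCategory.whiskerLeft_comp, θ.at_comp]

variable [MonoidalPreadditive C] [MonoidalLinear ℂ C] [BraidedCategory C]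

/-- The braiding of `C` twisted by two monoidal involutions of the identity functor. -/
def twistIso (X Y : C) : X ⊗ Y ≅ Y ⊗ X where
  hom := twistOp s θ X Y ≫ (β_ X Y).hom
  inv := (β_ X Y).inv ≫ twistOp s θ X Y
  hom_inv_id := by simp [twistOp_sq]
  inv_hom_id := by
    rw [Category.assoc, ← Category.assoc (twistOp s θ X Y), twistOp_sq]; simp

lemma twist_hexagon_forward (X Y Z : C) :
    (α_ X Y Z).hom ≫ (twistIso s θ X (Y ⊗ Z)).hom ≫ (α_ Y Z X).hom =
      (twistIso s θ X Y).hom ▷ Z ≫ (α_ Y X Z).hom ≫ Y ◁ (twistIso s θ X Z).hom := by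
  -- Moved to the front, the twist of `X` against `Y ⊗ Z` is `signOp a (b ≫ c)`, while the twists of
  -- `X` against `Y` and `Z` separately are `signOp a b` and `signOp a c`. Multiplicativity in the
  -- second slot reduces the claim to the untwisted hexagon.
  let a : (X ⊗ Y) ⊗ Z ⟶ (X ⊗ Y) ⊗ Z := (s.at X ▷ Y) ▷ Z
  let b : (X ⊗ Y) ⊗ Z ⟶ (X ⊗ Y) ⊗ Z := (X ◁ θ.at Y) ▷ Z
  let c : (X ⊗ Y) ⊗ Z ⟶ (X ⊗ Y) ⊗ Z := (X ⊗ Y) ◁ θ.at Z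
  have h1 : (α_ X Y Z).hom ≫ twistOp s θ X (Y ⊗ Z) = signOp a (b ≫ c) ≫ (α_ X Y Z).hom := by
    refine (signOp_naturality ?_ ?_).symm
    · simp [a]
    · simp [b, c, θ.at_tensor]
  have h2 : twistOp s θ X Y ▷ Z = signOp a b := map_signOp (tensorRight Z) _ _
  have h3 : (β_ X Y).hom ▷ Z ≫ (α_ Y X Z).hom ≫ Y ◁ twistOp s θ X Z =
      signOp a c ≫ (β_ X Y).hom ▷ Z ≫ (α_ Y X Z).hom := by
    have : Y ◁ twistOp s θ X Z = signOp (Y ◁ (s.at X ▷ Z)) (Y ◁ (X ◁ θ.at Z)) :=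
      map_signOp (tensorLeft Y) _ _
    rw [this, ← Category.assoc]
    refine (signOp_naturality ?_ ?_).symm
    · simp only [a, ← comp_whiskerRight_assoc, BraidedCategory.braiding_naturality_left]
      simp
    · dsimp only [c]
      rw [whisker_exchange_assoc]
      simp
  simp only [twistIso, comp_whiskerRight, MonoidalCategory.whiskerLeft_comp, Category.assoc]
  rw [reassoc_of% h1, h2, reassoc_of% h3, BraidedCategory.hexagon_forward,
    ← Category.assoc (signOp a b), signOp_comp_signOp]
  · simp only [a, ← comp_whiskerRight, s.at_sq, id_whiskerRight]
  · simp only [a, b, ← comp_whiskerRight, whisker_exchange]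

lemma twist_hexagon_reverse (X Y Z : C) :
    (α_ X Y Z).inv ≫ (twistIso s θ (X ⊗ Y) Z).hom ≫ (α_ Z X Y).inv =
      X ◁ (twistIso s θ Y Z).hom ≫ (α_ X Z Y).inv ≫ (twistIso s θ X Z).hom ▷ Y := by
  -- Same mechanism as for the forward hexagon, now with multiplicativity in the first slot.
  let a : X ⊗ Y ⊗ Z ⟶ X ⊗ Y ⊗ Z := s.at X ▷ (Y ⊗ Z)
  let b : X ⊗ Y ⊗ Z ⟶ X ⊗ Y ⊗ Z := X ◁ (s.at Y ▷ Z)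
  let c : X ⊗ Y ⊗ Z ⟶ X ⊗ Y ⊗ Z := X ◁ (Y ◁ θ.at Z)
  have hab : b ≫ a = a ≫ b := whisker_exchange _ _
  have h1 : (α_ X Y Z).inv ≫ twistOp s θ (X ⊗ Y) Z = signOp (b ≫ a) c ≫ (α_ X Y Z).inv := by
    refine (signOp_naturality ?_ ?_).symm
    · rw [hab]; simp [a, b, s.at_tensor]
    · simp [c]
  have h2 : X ◁ twistOp s θ Y Z = signOp b c := map_signOp (tensorLeft X) _ _
  have h3 : X ◁ (β_ Y Z).hom ≫ (α_ X Z Y).inv ≫ twistOp s θ X Z ▷ Y =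
      signOp a c ≫ X ◁ (β_ Y Z).hom ≫ (α_ X Z Y).inv := by
    have : twistOp s θ X Z ▷ Y = signOp ((s.at X ▷ Z) ▷ Y) ((X ◁ θ.at Z) ▷ Y) :=
      map_signOp (tensorRight Y) _ _
    rw [this, ← Category.assoc]
    refine (signOp_naturality ?_ ?_).symm
    · dsimp only [a]
      rw [← whisker_exchange_assoc]
      simp
    · simp only [c, ← MonoidalCategory.whiskerLeft_comp_assoc,
        BraidedCategory.braiding_naturality_right]
      simp
  simp only [twistIso, comp_whiskerRight, MonoidalCategory.whiskerLeft_comp, Category.assoc]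
  rw [reassoc_of% h1, h2, reassoc_of% h3, BraidedCategory.hexagon_reverse,
    ← Category.assoc (signOp b c), signOp_comp_signOp']
  · simp only [c, ← MonoidalCategory.whiskerLeft_comp, θ.at_sq, MonoidalCategory.whiskerLeft_id]
  · simp only [b, c, ← MonoidalCategory.whiskerLeft_comp, whisker_exchange]
  · exact (whisker_exchange _ _).symm

/-- The braiding of `C` twisted by two monoidal involutions of the identity functor. -/
@[reducible]
def twistedBraiding : BraidedCategory C where
  braiding := twistIso s θ
  braiding_naturality_right X Y Z f := by
    simp only [twistIso, Category.assoc, ← reassoc_of% (twistOp_whiskerLeft s θ f X),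
      BraidedCategory.braiding_naturality_right]
  braiding_naturality_left f Z := by
    simp only [twistIso, Category.assoc, ← reassoc_of% (twistOp_whiskerRight s θ f Z),
      BraidedCategory.braiding_naturality_left]
  hexagon_forward := twist_hexagon_forward s θ
  hexagon_reverse := twist_hexagon_reverse s θ

end Twist

/-! ### Categories generated by the unit object -/

section UnitGenerated

open TensorProduct

/-- Every object is a direct sum of copies of the unit, whose endomorphisms are scalars. -/
structure IsUnitGenerated (D : Type u) [Category.{v} D] [Preadditive D] [Linear ℂ D]
    [MonoidalCategory D] : Prop where
  unit_ne_zero : 𝟙 (𝟙_ D) ≠ 0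
  smul_id : ∀ f : 𝟙_ D ⟶ 𝟙_ D, ∃ c : ℂ, f = c • 𝟙 (𝟙_ D)
  total : ∀ X : D, ∃ (n : ℕ) (i : Fin n → (𝟙_ D ⟶ X)) (p : Fin n → (X ⟶ 𝟙_ D)),
    ∑ k, p k ≫ i k = 𝟙 X
  sum : ∀ n : ℕ, ∃ (X : D) (i : Fin n → (𝟙_ D ⟶ X)) (p : Fin n → (X ⟶ 𝟙_ D)),
    (∀ k l, i k ≫ p l = if k = l then 𝟙 _ else 0) ∧ ∑ k, p k ≫ i k = 𝟙 X

variable {D : Type u} [Category.{v} D] [Preadditive D] [Linear ℂ D] [MonoidalCategory D]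

namespace IsUnitGenerated

lemma smul_id_injective (hD : IsUnitGenerated D) {a b : ℂ}
    (h : a • 𝟙 (𝟙_ D) = b • 𝟙 (𝟙_ D)) : a = b := by
  by_contra hab
  have : (a - b) • 𝟙 (𝟙_ D) = 0 := by rw [sub_smul, h, sub_self]
  exact hD.unit_ne_zero ((smul_eq_zero.1 this).resolve_left (sub_ne_zero.2 hab))

/-- Endomorphisms of the unit are scalars. -/
def scalar (hD : IsUnitGenerated D) : (𝟙_ D ⟶ 𝟙_ D) →ₗ[ℂ] ℂ where
  toFun f := (hD.smul_id f).choose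
  map_add' f g := hD.smul_id_injective <| by
    rw [add_smul, ← (hD.smul_id _).choose_spec, ← (hD.smul_id _).choose_spec,
      ← (hD.smul_id _).choose_spec]
  map_smul' c f := hD.smul_id_injective <| by
    rw [RingHom.id_apply, smul_eq_mul, mul_smul, ← (hD.smul_id _).choose_spec,
      ← (hD.smul_id _).choose_spec]

lemma scalar_smul (hD : IsUnitGenerated D) (f : 𝟙_ D ⟶ 𝟙_ D) : hD.scalar f • 𝟙 (𝟙_ D) = f :=
  (hD.smul_id f).choose_spec.symm

lemma eq_sum (hD : IsUnitGenerated D) {X : D} {n : ℕ} {i : Fin n → (𝟙_ D ⟶ X)}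
    {p : Fin n → (X ⟶ 𝟙_ D)} (h : ∑ k, p k ≫ i k = 𝟙 X) (x : 𝟙_ D ⟶ X) :
    ∑ k, hD.scalar (x ≫ p k) • i k = x := by
  conv_rhs => rw [← Category.comp_id x, ← h, Preadditive.comp_sum]
  refine Finset.sum_congr rfl fun k _ => ?_
  rw [← Category.assoc]
  conv_rhs => rw [← hD.scalar_smul (x ≫ p k)]
  simp

/-- Finiteness allows `𝟙_ D ⟶ X`, which lives in `Type v`, to be replaced by a coordinate space in
`Type`, as the target `FGModuleCat.{0} ℂ` requires. -/
lemma finite_hom (hD : IsUnitGenerated D) (X : D) : Module.Finite ℂ (𝟙_ D ⟶ X) := by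
  classical
  obtain ⟨n, i, p, h⟩ := hD.total X
  refine ⟨⟨Finset.univ.image i, ?_⟩⟩
  rw [eq_top_iff]
  rintro x -
  rw [← hD.eq_sum h x]
  exact Submodule.sum_mem _ fun k _ => Submodule.smul_mem _ _ (Submodule.subset_span (by simp))

variable (D) in
/-- Coordinate space of `𝟙 ⟶ X`. -/
abbrev coord (X : D) : Type := Fin (Module.finrank ℂ (𝟙_ D ⟶ X)) → ℂ

/-- Coordinates on `𝟙 ⟶ X`. -/
def coordEquiv (hD : IsUnitGenerated D) (X : D) : (𝟙_ D ⟶ X) ≃ₗ[ℂ] coord D X :=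
  letI := hD.finite_hom X
  LinearEquiv.ofFinrankEq _ _ (by simp)

/-- The action of a morphism on coordinate spaces. -/
def coordMap (hD : IsUnitGenerated D) {X Y : D} (f : X ⟶ Y) : coord D X →ₗ[ℂ] coord D Y :=
  (hD.coordEquiv Y).toLinearMap ∘ₗ Linear.rightComp ℂ _ f ∘ₗ (hD.coordEquiv X).symm.toLinearMap

lemma coordMap_apply (hD : IsUnitGenerated D) {X Y : D} (f : X ⟶ Y) (x : 𝟙_ D ⟶ X) :
    hD.coordMap f (hD.coordEquiv X x) = hD.coordEquiv Y (x ≫ f) := by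
  simp [coordMap]

/-- The coordinate functor to finite-dimensional vector spaces. -/
def coordFunctor (hD : IsUnitGenerated D) : D ⥤ FGModuleCat.{0} ℂ where
  obj X := FGModuleCat.of ℂ (coord D X)
  map f := FGModuleCat.ofHom (hD.coordMap f)
  map_id X := by
    ext1
    refine LinearMap.ext fun x => ?_
    obtain ⟨x, rfl⟩ := (hD.coordEquiv X).surjective x
    refine (hD.coordMap_apply _ _).trans ?_
    rw [Category.comp_id]; rfl
  map_comp {X Y Z} f g := by
    ext1
    refine LinearMap.ext fun x => ?_
    obtain ⟨x, rfl⟩ := (hD.coordEquiv X).surjective x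
    refine (hD.coordMap_apply _ _).trans ?_
    refine Eq.trans ?_ (congrArg (hD.coordMap g) (hD.coordMap_apply f x)).symm
    rw [hD.coordMap_apply, Category.assoc]

/-- The unit of the coordinate functor. -/
def coordUnit (hD : IsUnitGenerated D) : ℂ ≃ₗ[ℂ] coord D (𝟙_ D) :=
  (LinearEquiv.ofBijective (LinearMap.toSpanSingleton ℂ _ (𝟙 (𝟙_ D)))
    ⟨fun _ _ h => hD.smul_id_injective h, fun f => ⟨hD.scalar f, hD.scalar_smul f⟩⟩).trans
    (hD.coordEquiv (𝟙_ D))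

lemma coordUnit_apply (hD : IsUnitGenerated D) (c : ℂ) :
    hD.coordUnit c = hD.coordEquiv _ (c • 𝟙 (𝟙_ D)) := rfl

variable [MonoidalPreadditive D] [MonoidalLinear ℂ D]

/-- The tensor product of morphisms from the unit. -/
def tensorUnitHom (X Y : D) : (𝟙_ D ⟶ X) →ₗ[ℂ] (𝟙_ D ⟶ Y) →ₗ[ℂ] (𝟙_ D ⟶ X ⊗ Y) :=
  LinearMap.mk₂ ℂ (fun x y => (λ_ (𝟙_ D)).inv ≫ (x ⊗ₘ y))
    (fun x x' y => by simp [MonoidalPreadditive.add_tensor])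
    (fun c x y => by simp [MonoidalCategory.tensorHom_def])
    (fun x y y' => by simp [MonoidalPreadditive.tensor_add])
    (fun c x y => by simp [MonoidalCategory.tensorHom_def])

lemma tensorUnitHom_apply {X Y : D} (x : 𝟙_ D ⟶ X) (y : 𝟙_ D ⟶ Y) :
    tensorUnitHom X Y x y = (λ_ (𝟙_ D)).inv ≫ (x ⊗ₘ y) := rfl

/-- The tensorator on coordinates. -/
def coordTensor (hD : IsUnitGenerated D) (X Y : D) :
    coord D X ⊗[ℂ] coord D Y →ₗ[ℂ] coord D (X ⊗ Y) :=
  (hD.coordEquiv (X ⊗ Y)).toLinearMap ∘ₗ TensorProduct.lift (tensorUnitHom X Y) ∘ₗ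
    TensorProduct.map (hD.coordEquiv X).symm.toLinearMap (hD.coordEquiv Y).symm.toLinearMap

lemma coordTensor_tmul (hD : IsUnitGenerated D) {X Y : D} (x : 𝟙_ D ⟶ X) (y : 𝟙_ D ⟶ Y) :
    hD.coordTensor X Y (hD.coordEquiv X x ⊗ₜ hD.coordEquiv Y y) =
      hD.coordEquiv (X ⊗ Y) ((λ_ (𝟙_ D)).inv ≫ (x ⊗ₘ y)) := by
  simp [coordTensor, tensorUnitHom_apply]

/-- The inverse `L` is explicit: resolutions of the identity of `X` and of `Y` tensor to one of `X ⊗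
Y`, and the scalars `z ≫ (p k ⊗ₘ q l)` are the coefficients of `z` along the `i k ⊗ j l`. -/
lemma lift_tensorUnitHom_bijective (hD : IsUnitGenerated D) (X Y : D) :
    Function.Bijective (TensorProduct.lift (tensorUnitHom X Y)) := by
  obtain ⟨n, i, p, h⟩ := hD.total X
  obtain ⟨m, j, q, h'⟩ := hD.total Y
  let L : (𝟙_ D ⟶ X ⊗ Y) →ₗ[ℂ] (𝟙_ D ⟶ X) ⊗[ℂ] (𝟙_ D ⟶ Y) :=
    ∑ k, ∑ l, (LinearMap.toSpanSingleton ℂ _ (i k ⊗ₜ[ℂ] j l)) ∘ₗ hD.scalar ∘ₗ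
      Linear.rightComp ℂ _ ((p k ⊗ₘ q l) ≫ (λ_ _).hom)
  have hL : ∀ z, L z =
      ∑ k, ∑ l, hD.scalar (z ≫ (p k ⊗ₘ q l) ≫ (λ_ _).hom) • (i k ⊗ₜ[ℂ] j l) := fun z => by
    simp [L, LinearMap.sum_apply]
  have hunit : ∀ f g : 𝟙_ D ⟶ 𝟙_ D,
      hD.scalar ((λ_ _).inv ≫ (f ⊗ₘ g) ≫ (λ_ _).hom) = hD.scalar f * hD.scalar g := by
    intro f g
    refine hD.smul_id_injective ?_
    rw [hD.scalar_smul]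
    conv_lhs => rw [← hD.scalar_smul f, ← hD.scalar_smul g]
    simp [MonoidalCategory.tensorHom_def, smul_smul]
    rw [mul_comm]
  constructor
  · refine Function.LeftInverse.injective (g := L) fun t => ?_
    refine LinearMap.congr_fun (f := L ∘ₗ TensorProduct.lift (tensorUnitHom X Y))
      (g := LinearMap.id) (TensorProduct.ext' fun x y => ?_) t
    simp only [LinearMap.comp_apply, TensorProduct.lift.tmul, tensorUnitHom_apply,
      LinearMap.id_apply]
    rw [hL]
    conv_rhs => rw [← hD.eq_sum h x, ← hD.eq_sum h' y, TensorProduct.sum_tmul]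
    refine Finset.sum_congr rfl fun k _ => ?_
    rw [TensorProduct.tmul_sum]
    refine Finset.sum_congr rfl fun l _ => ?_
    rw [TensorProduct.smul_tmul_smul, Category.assoc, tensorHom_comp_tensorHom_assoc, hunit]
  · intro z
    refine ⟨L z, ?_⟩
    have htot : ∑ k, ∑ l, (p k ⊗ₘ q l) ≫ (i k ⊗ₘ j l) = 𝟙 (X ⊗ Y) := by
      simp_rw [tensorHom_comp_tensorHom, ← tensor_sum, ← sum_tensor]
      rw [h, h', id_tensorHom_id]
    rw [hL]
    conv_rhs => rw [← Category.comp_id z, ← htot, Preadditive.comp_sum]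
    rw [map_sum]
    refine Finset.sum_congr rfl fun k _ => ?_
    rw [Preadditive.comp_sum, map_sum]
    refine Finset.sum_congr rfl fun l _ => ?_
    rw [map_smul, TensorProduct.lift.tmul, tensorUnitHom_apply]
    have := hD.scalar_smul (z ≫ (p k ⊗ₘ q l) ≫ (λ_ _).hom)
    rw [← Category.id_comp ((λ_ (𝟙_ D)).inv ≫ (i k ⊗ₘ j l)), ← Linear.smul_comp, this]
    simp

lemma coordTensor_bijective (hD : IsUnitGenerated D) (X Y : D) :
    Function.Bijective (hD.coordTensor X Y) :=
  (hD.coordEquiv (X ⊗ Y)).bijective.comp ((hD.lift_tensorUnitHom_bijective X Y).comp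
    (TensorProduct.congr (hD.coordEquiv X).symm (hD.coordEquiv Y).symm).bijective)

end IsUnitGenerated

end UnitGenerated

/-! ### The coordinate functor is a braided equivalence with vector spaces. -/

namespace IsUnitGenerated

open TensorProduct

section Functor

variable {D : Type u} [Category.{v} D] [Preadditive D] [Linear ℂ D] [MonoidalCategory D]

lemma coordFunctor_additive (hD : IsUnitGenerated D) : hD.coordFunctor.Additive where
  map_add {X Y f g} := by
    ext1
    refine LinearMap.ext fun x => ?_
    obtain ⟨x, rfl⟩ := (hD.coordEquiv X).surjective x
    refine (hD.coordMap_apply _ _).trans ?_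
    rw [Preadditive.comp_add, map_add, ← hD.coordMap_apply, ← hD.coordMap_apply]
    rfl

lemma coordFunctor_linear (hD : IsUnitGenerated D) : hD.coordFunctor.Linear ℂ where
  map_smul {X Y} f c := by
    ext1
    refine LinearMap.ext fun x => ?_
    obtain ⟨x, rfl⟩ := (hD.coordEquiv X).surjective x
    refine (hD.coordMap_apply _ _).trans ?_
    rw [Linear.comp_smul, map_smul, ← hD.coordMap_apply]
    rfl

lemma coordFunctor_faithful (hD : IsUnitGenerated D) : hD.coordFunctor.Faithful where
  map_injective {X Y f g} h := by
    have h' : ∀ x : 𝟙_ D ⟶ X, x ≫ f = x ≫ g := fun x => by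
      have := congrArg (fun φ => φ.hom.hom (hD.coordEquiv X x)) h
      have := (hD.coordMap_apply f x).symm.trans (this.trans (hD.coordMap_apply g x))
      exact (hD.coordEquiv Y).injective this
    obtain ⟨n, i, p, hX⟩ := hD.total X
    rw [← Category.id_comp f, ← Category.id_comp g, ← hX, Preadditive.sum_comp,
      Preadditive.sum_comp]
    simp only [Category.assoc, h']

lemma coordFunctor_full (hD : IsUnitGenerated D) : hD.coordFunctor.Full where
  map_surjective {X Y} φ := by
    obtain ⟨n, i, p, hX⟩ := hD.total X
    let ψ : (𝟙_ D ⟶ X) →ₗ[ℂ] (𝟙_ D ⟶ Y) :=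
      (hD.coordEquiv Y).symm.toLinearMap ∘ₗ φ.hom.hom ∘ₗ (hD.coordEquiv X).toLinearMap
    refine ⟨∑ k, p k ≫ ψ (i k), ?_⟩
    ext1
    refine LinearMap.ext fun x => ?_
    obtain ⟨x, rfl⟩ := (hD.coordEquiv X).surjective x
    refine (hD.coordMap_apply _ _).trans ?_
    -- The preimage prescribes `ψ` on the spanning family `i k`; expanding `x` along it recovers `ψ
    -- x` by linearity.
    have h : x ≫ ∑ k, p k ≫ ψ (i k) = ψ x := by
      conv_rhs => rw [← hD.eq_sum hX x]
      rw [Preadditive.comp_sum, map_sum]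
      refine Finset.sum_congr rfl fun k _ => ?_
      rw [map_smul, ← Category.assoc]
      conv_lhs => rw [← hD.scalar_smul (x ≫ p k)]
      simp
    rw [h]
    exact (hD.coordEquiv Y).apply_symm_apply _

lemma coordFunctor_essSurj (hD : IsUnitGenerated D) : hD.coordFunctor.EssSurj where
  mem_essImage V := by
    obtain ⟨X, i, p, horth, htot⟩ := hD.sum (Module.finrank ℂ V)
    let e : (𝟙_ D ⟶ X) ≃ₗ[ℂ] (Fin (Module.finrank ℂ V) → ℂ) :=
      { toFun x k := hD.scalar (x ≫ p k)
        map_add' x y := by ext k; simp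
        map_smul' c x := by ext k; simp
        invFun c := ∑ k, c k • i k
        left_inv x := hD.eq_sum htot x
        right_inv c := by
          ext l
          refine hD.smul_id_injective ?_
          rw [hD.scalar_smul, Preadditive.sum_comp]
          simp [horth] }
    refine ⟨X, ⟨?_⟩⟩
    exact ((hD.coordEquiv X).symm.trans (e.trans
      (LinearEquiv.ofFinrankEq (Fin (Module.finrank ℂ V) → ℂ) V (by simp)))).toFGModuleCatIso

lemma coord_ext₂ (hD : IsUnitGenerated D) {X Y : D} {W : Type} [AddCommGroup W] [Module ℂ W]
    {f g : coord D X ⊗[ℂ] coord D Y →ₗ[ℂ] W}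
    (h : ∀ x y, f (hD.coordEquiv X x ⊗ₜ hD.coordEquiv Y y) =
      g (hD.coordEquiv X x ⊗ₜ hD.coordEquiv Y y)) : f = g := by
  refine TensorProduct.ext' fun x y => ?_
  obtain ⟨x, rfl⟩ := (hD.coordEquiv X).surjective x
  obtain ⟨y, rfl⟩ := (hD.coordEquiv Y).surjective y
  exact h x y

lemma coord_ext₃ (hD : IsUnitGenerated D) {X Y Z : D} {W : Type} [AddCommGroup W] [Module ℂ W]
    {f g : (coord D X ⊗[ℂ] coord D Y) ⊗[ℂ] coord D Z →ₗ[ℂ] W}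
    (h : ∀ x y z, f ((hD.coordEquiv X x ⊗ₜ hD.coordEquiv Y y) ⊗ₜ hD.coordEquiv Z z) =
      g ((hD.coordEquiv X x ⊗ₜ hD.coordEquiv Y y) ⊗ₜ hD.coordEquiv Z z)) : f = g := by
  refine TensorProduct.ext_threefold fun x y z => ?_
  obtain ⟨x, rfl⟩ := (hD.coordEquiv X).surjective x
  obtain ⟨y, rfl⟩ := (hD.coordEquiv Y).surjective y
  obtain ⟨z, rfl⟩ := (hD.coordEquiv Z).surjective z
  exact h x y z

end Functor

section Monoidal

variable {D : Type u} [Category.{v} D] [Preadditive D] [Linear ℂ D] [MonoidalCategory D]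
  [MonoidalPreadditive D] [MonoidalLinear ℂ D]

lemma coord_natural_left (hD : IsUnitGenerated D) {X Y : D} (f : X ⟶ Y) (Z : D) :
    hD.coordTensor Y Z ∘ₗ LinearMap.rTensor _ (hD.coordMap f) =
      hD.coordMap (f ▷ Z) ∘ₗ hD.coordTensor X Z := by
  refine hD.coord_ext₂ fun x y => ?_
  simp only [LinearMap.comp_apply, LinearMap.rTensor_tmul, coordMap_apply, coordTensor_tmul]
  congr 1
  rw [Category.assoc, ← tensorHom_id, tensorHom_comp_tensorHom, Category.comp_id]

lemma coord_natural_right (hD : IsUnitGenerated D) {X Y : D} (Z : D) (f : X ⟶ Y) :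
    hD.coordTensor Z Y ∘ₗ LinearMap.lTensor _ (hD.coordMap f) =
      hD.coordMap (Z ◁ f) ∘ₗ hD.coordTensor Z X := by
  refine hD.coord_ext₂ fun x y => ?_
  simp only [LinearMap.comp_apply, LinearMap.lTensor_tmul, coordMap_apply, coordTensor_tmul]
  congr 1
  rw [Category.assoc, ← id_tensorHom, tensorHom_comp_tensorHom, Category.comp_id]

lemma coord_associativity (hD : IsUnitGenerated D) (X Y Z : D) :
    hD.coordMap (α_ X Y Z).hom ∘ₗ hD.coordTensor (X ⊗ Y) Z ∘ₗ
        LinearMap.rTensor _ (hD.coordTensor X Y) =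
      hD.coordTensor X (Y ⊗ Z) ∘ₗ LinearMap.lTensor _ (hD.coordTensor Y Z) ∘ₗ
        (TensorProduct.assoc ℂ _ _ _).toLinearMap := by
  refine hD.coord_ext₃ fun x y z => ?_
  simp only [LinearMap.comp_apply, LinearMap.rTensor_tmul, LinearMap.lTensor_tmul,
    LinearEquiv.coe_coe, TensorProduct.assoc_tmul, coordMap_apply, coordTensor_tmul]
  congr 1
  simp only [MonoidalCategory.tensorHom_def, Category.assoc, comp_whiskerRight,
    MonoidalCategory.whiskerLeft_comp]
  monoidal

lemma coord_left_unitality (hD : IsUnitGenerated D) (X : D) :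
    (TensorProduct.lid ℂ (coord D X)).toLinearMap =
      hD.coordMap (λ_ X).hom ∘ₗ hD.coordTensor (𝟙_ D) X ∘ₗ
        LinearMap.rTensor _ hD.coordUnit.toLinearMap := by
  refine TensorProduct.ext' fun c x => ?_
  obtain ⟨x, rfl⟩ := (hD.coordEquiv X).surjective x
  simp only [LinearMap.comp_apply, LinearMap.rTensor_tmul, LinearEquiv.coe_coe,
    coordUnit_apply, coordMap_apply, coordTensor_tmul, TensorProduct.lid_tmul]
  rw [← map_smul]
  congr 1
  simp [MonoidalCategory.tensorHom_def]

lemma coord_right_unitality (hD : IsUnitGenerated D) (X : D) :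
    (TensorProduct.rid ℂ (coord D X)).toLinearMap =
      hD.coordMap (ρ_ X).hom ∘ₗ hD.coordTensor X (𝟙_ D) ∘ₗ
        LinearMap.lTensor _ hD.coordUnit.toLinearMap := by
  refine TensorProduct.ext' fun x c => ?_
  obtain ⟨x, rfl⟩ := (hD.coordEquiv X).surjective x
  simp only [LinearMap.comp_apply, LinearMap.lTensor_tmul, LinearEquiv.coe_coe,
    coordUnit_apply, coordMap_apply, coordTensor_tmul, TensorProduct.rid_tmul]
  rw [← map_smul]
  congr 1
  simp [MonoidalCategory.tensorHom_def, unitors_inv_equal]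

/-- By naturality the braiding of `X` and `Y` is tested on morphisms from the unit, whose
self-braiding is trivial. -/
lemma coord_braided [BraidedCategory D] (hD : IsUnitGenerated D) (X Y : D) :
    hD.coordMap (β_ X Y).hom ∘ₗ hD.coordTensor X Y =
      hD.coordTensor Y X ∘ₗ (TensorProduct.comm ℂ _ _).toLinearMap := by
  refine hD.coord_ext₂ fun x y => ?_
  simp only [LinearMap.comp_apply, LinearEquiv.coe_coe, TensorProduct.comm_tmul, coordMap_apply,
    coordTensor_tmul]
  congr 1
  rw [Category.assoc, BraidedCategory.braiding_naturality]
  simp [unitors_inv_equal]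

/-- The coordinate functor is monoidal. -/
@[reducible]
def coordMonoidal (hD : IsUnitGenerated D) : hD.coordFunctor.Monoidal :=
  Functor.CoreMonoidal.toMonoidal
    { εIso := hD.coordUnit.toFGModuleCatIso
      μIso X Y := (LinearEquiv.ofBijective _ (hD.coordTensor_bijective X Y)).toFGModuleCatIso
      μIso_hom_natural_left f Z := FGModuleCat.hom_ext (hD.coord_natural_left f Z)
      μIso_hom_natural_right Z f := FGModuleCat.hom_ext (hD.coord_natural_right Z f)
      associativity X Y Z := FGModuleCat.hom_ext (hD.coord_associativity X Y Z)
      left_unitality X := FGModuleCat.hom_ext (hD.coord_left_unitality X)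
      right_unitality X := FGModuleCat.hom_ext (hD.coord_right_unitality X) }

/-- A braided category generated by its unit is equivalent to finite-dimensional vector spaces. -/
lemma braidedEquivalent [BraidedCategory D] (hD : IsUnitGenerated D) :
    BraidedEquivalent D (FGModuleCat.{0} ℂ) := by
  let _ := hD.coordMonoidal
  refine ⟨hD.coordFunctor, { braided := fun X Y => ?_ }, hD.coordFunctor_additive,
    hD.coordFunctor_linear, ?_⟩
  · exact FGModuleCat.hom_ext (hD.coord_braided X Y)
  · have := hD.coordFunctor_faithful
    have := hD.coordFunctor_full
    have := hD.coordFunctor_essSurj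
    exact {}

end Monoidal

end IsUnitGenerated

/-! ### Duals in monoidal categories -/

section Duals

variable {C : Type u} [Category.{v} C] [MonoidalCategory C]

lemma rightDualIso_hom_comp_evaluation {X Y₁ Y₂ : C} (p₁ : ExactPairing X Y₁)
    (p₂ : ExactPairing X Y₂) : (rightDualIso p₁ p₂).hom ▷ X ≫ ε_ X Y₂ = ε_ X Y₁ := by
  -- `rightDualIso` is the mate of `𝟙 X` for two different choices of dual of the same object,
  -- supplied here as explicit instances.
  have := @rightAdjointMate_comp_evaluation C _ _ X X ⟨Y₂⟩ ⟨Y₁⟩ (𝟙 X)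
  rw [MonoidalCategory.whiskerLeft_id, Category.id_comp] at this
  exact this

lemma rightDualIso_inv_comp_evaluation {X Y₁ Y₂ : C} (p₁ : ExactPairing X Y₁)
    (p₂ : ExactPairing X Y₂) : (rightDualIso p₁ p₂).inv ▷ X ≫ ε_ X Y₁ = ε_ X Y₂ :=
  rightDualIso_hom_comp_evaluation p₂ p₁

lemma coevaluation_comp_rightDualIso_hom {X Y₁ Y₂ : C} (p₁ : ExactPairing X Y₁)
    (p₂ : ExactPairing X Y₂) : η_ X Y₁ ≫ X ◁ (rightDualIso p₁ p₂).hom = η_ X Y₂ := by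
  have := @coevaluation_comp_rightAdjointMate C _ _ X X ⟨Y₂⟩ ⟨Y₁⟩ (𝟙 X)
  rw [id_whiskerRight, Category.comp_id] at this
  exact this

/-- Morphisms to a right dual are determined by the pairing with evaluation. -/
lemma rightDual_hom_ext {X Y : C} [HasRightDual X] {f g : Y ⟶ Xᘁ}
    (h : f ▷ X ≫ ε_ X Xᘁ = g ▷ X ≫ ε_ X Xᘁ) : f = g := by
  have := congrArg (tensorRightHomEquiv Y X Xᘁ (𝟙_ C)) h
  simpa using this

lemma coevaluation_left_ext {Y Y' Z : C} [ExactPairing Y Y'] {f g : Y' ⟶ Z}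
    (h : η_ Y Y' ≫ Y ◁ f = η_ Y Y' ≫ Y ◁ g) : f = g := by
  have := congrArg (tensorLeftHomEquiv (𝟙_ C) Y Y' Z).symm h
  simpa using this

variable [RigidCategory C]

/-- The mate of a tensor product of morphisms. -/
lemma rightAdjointMate_tensor_comp_rightDualTensorIso {X X' Y Y' : C} (f : X ⟶ X')
    (g : Y ⟶ Y') :
    rightAdjointMate (f ⊗ₘ g) ≫ (rightDualTensorIso X Y).hom =
      (rightDualTensorIso X' Y').hom ≫ (rightAdjointMate g ⊗ₘ rightAdjointMate f) := by
  refine coevaluation_left_ext (Y := X' ⊗ Y') (Y' := (X' ⊗ Y')ᘁ) ?_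
  rw [MonoidalCategory.whiskerLeft_comp, coevaluation_comp_rightAdjointMate_assoc,
    ← whisker_exchange, MonoidalCategory.whiskerLeft_comp]
  have h1 : η_ (X ⊗ Y) (X ⊗ Y)ᘁ ≫ (X ⊗ Y) ◁ (rightDualTensorIso X Y).hom =
    η_ (X ⊗ Y) (Yᘁ ⊗ Xᘁ) := coevaluation_comp_rightDualIso_hom _ _
  have h2 : η_ (X' ⊗ Y') (X' ⊗ Y')ᘁ ≫ (X' ⊗ Y') ◁ (rightDualTensorIso X' Y').hom =
    η_ (X' ⊗ Y') (Y'ᘁ ⊗ X'ᘁ) := coevaluation_comp_rightDualIso_hom _ _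
  rw [reassoc_of% h1, reassoc_of% h2, ExactPairing.tensor_coevaluation,
    ExactPairing.tensor_coevaluation]
  have hf := coevaluation_comp_rightAdjointMate f
  have hg := coevaluation_comp_rightAdjointMate g
  calc
    _ = η_ X Xᘁ ⊗≫ (X ◁ η_ Y Yᘁ ≫ f ▷ (Y ⊗ Yᘁ)) ▷ Xᘁ ⊗≫ (X' ◁ g ▷ Yᘁ) ▷ Xᘁ ⊗≫ 𝟙 _ := by
      rw [MonoidalCategory.tensorHom_def]; monoidal
    _ = (η_ X Xᘁ ≫ f ▷ Xᘁ) ⊗≫ (X' ◁ (η_ Y Yᘁ ≫ g ▷ Yᘁ)) ▷ Xᘁ ⊗≫ 𝟙 _ := by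
      rw [whisker_exchange]; monoidal
    _ = η_ X' X'ᘁ ⊗≫ X' ◁ ((𝟙_ C) ◁ rightAdjointMate f ≫ η_ Y' Y'ᘁ ▷ Xᘁ) ⊗≫
          X' ◁ Y' ◁ rightAdjointMate g ▷ Xᘁ ⊗≫ 𝟙 _ := by
      rw [← hf, ← hg]; monoidal
    _ = _ := by
      rw [whisker_exchange, tensorHom_def']; monoidal

/-- The canonical morphism `X** ⊗ Y** ⟶ (X ⊗ Y)**` in terms of evaluations. -/
lemma doubleDualTensor_comp_evaluation (X Y : C) :
    doubleDualTensor X Y ▷ dual (X ⊗ Y) ≫ ε_ (dual (X ⊗ Y)) (dual (dual (X ⊗ Y))) =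
      (dual (dual X) ⊗ dual (dual Y)) ◁ (rightDualTensorIso X Y).hom ≫
        ε_ (dual Y ⊗ dual X) (dual (dual X) ⊗ dual (dual Y)) := by
  rw [doubleDualTensor, comp_whiskerRight, Category.assoc, rightAdjointMate_comp_evaluation,
    ← whisker_exchange_assoc]
  congr 1
  exact rightDualIso_inv_comp_evaluation _ _

/-- The evaluation of a tensor product is nested: the inner pair `Y`, `Y'` is contracted first, then
the outer pair `X`, `X'`. -/
lemma tensor_comp_evaluation {X X' Y Y' : C} (f : X ⟶ X'ᘁ) (g : Y ⟶ Y'ᘁ) :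
    (f ⊗ₘ g) ▷ (Y' ⊗ X') ≫ ε_ (Y' ⊗ X') (X'ᘁ ⊗ Y'ᘁ) =
      𝟙 _ ⊗≫ X ◁ (g ▷ Y' ≫ ε_ Y' Y'ᘁ) ▷ X' ⊗≫ f ▷ X' ≫ ε_ X' X'ᘁ := by
  rw [ExactPairing.tensor_evaluation]
  calc
    _ = 𝟙 _ ⊗≫ X ◁ g ▷ Y' ▷ X' ⊗≫ (f ▷ (Y'ᘁ ⊗ Y') ≫ X'ᘁ ◁ ε_ Y' Y'ᘁ) ▷ X' ⊗≫
          ε_ X' X'ᘁ := by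
      rw [tensorHom_def']; monoidal
    _ = _ := by
      rw [← whisker_exchange]; monoidal

/-- Naturality of the canonical morphism `X** ⊗ Y** ⟶ (X ⊗ Y)**`. -/
lemma doubleDualTensor_naturality {X X' Y Y' : C} (f : X ⟶ X') (g : Y ⟶ Y') :
    (rightAdjointMate (rightAdjointMate f) ⊗ₘ rightAdjointMate (rightAdjointMate g)) ≫
        doubleDualTensor X' Y' =
      doubleDualTensor X Y ≫ rightAdjointMate (rightAdjointMate (f ⊗ₘ g)) := by
  apply rightDual_hom_ext
  rw [comp_whiskerRight, Category.assoc, doubleDualTensor_comp_evaluation, comp_whiskerRight,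
    Category.assoc, rightAdjointMate_comp_evaluation, ← whisker_exchange_assoc,
    ← whisker_exchange_assoc, doubleDualTensor_comp_evaluation, ← MonoidalCategory.whiskerLeft_comp_assoc,
    rightAdjointMate_tensor_comp_rightDualTensorIso, MonoidalCategory.whiskerLeft_comp_assoc]
  congr 1
  rw [tensor_comp_evaluation, rightAdjointMate_comp_evaluation, rightAdjointMate_comp_evaluation,
    ExactPairing.tensor_evaluation]
  symm
  calc
    _ = 𝟙 _ ⊗≫ dual (dual X) ◁ dual (dual Y) ◁ rightAdjointMate g ▷ dual X' ⊗≫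
          dual (dual X) ◁ ((dual (dual Y) ⊗ dual Y) ◁ rightAdjointMate f ≫
            ε_ (dual Y) (dual (dual Y)) ▷ dual X) ⊗≫ ε_ (dual X) (dual (dual X)) := by
      rw [MonoidalCategory.tensorHom_def]; monoidal
    _ = _ := by
      rw [whisker_exchange]; monoidal

end Duals

/-! ### Duals of invertible objects -/

section Invertible

variable {C : Type u} [Category.{v} C] [MonoidalCategory C]

lemma IsInvertibleObj.isEquivalence_tensorLeft_dual {X Y : C} (h : IsInvertibleObj X)
    [ExactPairing X Y] : (tensorLeft Y).IsEquivalence := by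
  have := h.isEquivalence_tensorLeft
  exact (tensorLeftAdjunction X Y).isEquivalence_left_of_isEquivalence_right

/-- Up to a unitor, the coevaluation is the unit at `𝟙_ C` of the adjunction between `tensorLeft Y`
and `tensorLeft X`, which is an adjunction of equivalences. -/
lemma IsInvertibleObj.isIso_coevaluation {X Y : C} (h : IsInvertibleObj X)
    [ExactPairing X Y] : IsIso (η_ X Y) := by
  have := h.isEquivalence_tensorLeft_dual (Y := Y)
  have h1 : IsIso ((tensorLeftAdjunction X Y).unit.app (𝟙_ C)) := inferInstance
  have h2 : (tensorLeftAdjunction X Y).unit.app (𝟙_ C) = η_ X Y ≫ X ◁ (ρ_ Y).inv := by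
    simp [unitors_inv_equal, tensorLeftAdjunction, tensorLeftHomEquiv, Adjunction.mkOfHomEquiv]
  rw [h2] at h1
  exact IsIso.of_isIso_comp_right _ (X ◁ (ρ_ Y).inv)

lemma IsInvertibleObj.isIso_evaluation {X Y : C} (h : IsInvertibleObj X)
    [ExactPairing X Y] : IsIso (ε_ X Y) := by
  have := h.isEquivalence_tensorLeft
  have h1 : IsIso ((tensorLeftAdjunction X Y).counit.app (𝟙_ C)) := inferInstance
  have h2 : (tensorLeftAdjunction X Y).counit.app (𝟙_ C) = Y ◁ (ρ_ X).hom ≫ ε_ X Y := by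
    simp [unitors_equal, tensorLeftAdjunction, tensorLeftHomEquiv, Adjunction.mkOfHomEquiv]
  rw [h2] at h1
  exact IsIso.of_isIso_comp_left (Y ◁ (ρ_ X).hom) _

lemma IsInvertibleObj.dual {X : C} (h : IsInvertibleObj X) [HasRightDual X] :
    IsInvertibleObj (HasRightDual.rightDual X) := by
  have := h.isIso_coevaluation (Y := HasRightDual.rightDual X)
  have := h.isIso_evaluation (Y := HasRightDual.rightDual X)
  exact ⟨X, ⟨asIso (ε_ X _)⟩, ⟨(asIso (η_ X _)).symm⟩⟩

end Invertible

/-! ### Spherical structures on pointed fusion categories -/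

section Spherical

/-- A natural transformation of additive functors is an isomorphism if it is so on summands. -/
lemma isIso_app_of_isSumOf {C : Type u} [Category.{v} C] [Preadditive C] {F G : C ⥤ C} [F.Additive] [G.Additive] {P : C → Prop}
    (α : F ⟶ G) (h : ∀ S, P S → IsIso (α.app S)) {X : C} (hX : IsSumOf P X) :
    IsIso (α.app X) := by
  obtain ⟨J, _, S, i, p, hP, htot⟩ := hX.exists_total
  have := fun k => h _ (hP k)
  refine ⟨∑ k, G.map (p k) ≫ inv (α.app (S k)) ≫ F.map (i k), ?_, ?_⟩
  · rw [Preadditive.comp_sum, ← F.map_id, ← htot, F.map_sum]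
    refine Finset.sum_congr rfl fun k _ => ?_
    rw [← α.naturality_assoc, IsIso.hom_inv_id_assoc, F.map_comp]
  · rw [Preadditive.sum_comp, ← G.map_id, ← htot, G.map_sum]
    refine Finset.sum_congr rfl fun k _ => ?_
    simp

variable {C : Type u} [Category.{v} C] [MonoidalCategory C] [RigidCategory C]

variable (C) in
/-- The double dual functor. -/
def doubleDual : C ⥤ C where
  obj X := dual (dual X)
  map f := rightAdjointMate (rightAdjointMate f)
  map_comp f g := by rw [comp_rightAdjointMate, comp_rightAdjointMate]

lemma rightAdjointMate_add [Preadditive C] [MonoidalPreadditive C] {X Y : C} (f g : X ⟶ Y) :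
    rightAdjointMate (f + g) = rightAdjointMate f + rightAdjointMate g := by
  simp [rightAdjointMate, MonoidalPreadditive.whiskerLeft_add, MonoidalPreadditive.add_whiskerRight]

instance [Preadditive C] [MonoidalPreadditive C] : (doubleDual C).Additive where
  map_add {_ _ f g} := by
    simp only [doubleDual, rightAdjointMate_add]
    rfl

/-- The canonical isomorphism of an invertible object with its double dual, for which the trace
of the identity is the identity. -/
def invertibleDoubleDual {X : C} (h : IsInvertibleObj X) : X ⟶ dual (dual X) :=
  letI := h.isIso_coevaluation (Y := dual X)
  tensorRightHomEquiv X (dual X) (dual (dual X)) (𝟙_ C) (inv (η_ X (dual X))) ≫ (λ_ _).hom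

lemma coevaluation_invertibleDoubleDual {X : C} (h : IsInvertibleObj X) :
    η_ X (dual X) ≫ invertibleDoubleDual h ▷ dual X ≫ ε_ (dual X) (dual (dual X)) = 𝟙 _ := by
  have := h.isIso_coevaluation (Y := dual X)
  rw [← IsIso.eq_inv_comp, Category.comp_id]
  apply (tensorRightHomEquiv X (dual X) (dual (dual X)) (𝟙_ C)).injective
  rw [tensorRightHomEquiv_whiskerRight_comp_evaluation]
  simp [invertibleDoubleDual]

/-- A morphism to the double dual of an invertible object is determined by its trace. -/
lemma invertible_doubleDual_ext {X : C} (h : IsInvertibleObj X) {f g : X ⟶ dual (dual X)}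
    (hfg : η_ X (dual X) ≫ f ▷ dual X ≫ ε_ (dual X) (dual (dual X)) =
      η_ X (dual X) ≫ g ▷ dual X ≫ ε_ (dual X) (dual (dual X))) : f = g := by
  have := h.isIso_coevaluation (Y := dual X)
  exact rightDual_hom_ext ((cancel_epi _).1 hfg)

/-- Cyclicity of the trace: `g` is carried around the loop, the naturality of evaluation and
coevaluation each removing one mate. -/
lemma trace_conj {X Y : C} (p : X ⟶ Y) (g : Y ⟶ X) (a : Y ⟶ dual (dual Y)) :
    η_ X (dual X) ≫ (p ≫ a ≫ rightAdjointMate (rightAdjointMate g)) ▷ dual X ≫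
        ε_ (dual X) (dual (dual X)) =
      η_ Y (dual Y) ≫ (g ≫ p ≫ a) ▷ dual Y ≫ ε_ (dual Y) (dual (dual Y)) := by
  rw [comp_whiskerRight, comp_whiskerRight, Category.assoc, Category.assoc,
    rightAdjointMate_comp_evaluation, ← whisker_exchange_assoc, ← whisker_exchange_assoc,
    coevaluation_comp_rightAdjointMate_assoc]
  simp

/-- By cyclicity, conjugating the canonical map of `Y` by `f` gives a map of trace `1`, and on an
invertible object there is only one. -/
lemma invertibleDoubleDual_naturality {X Y : C} (hX : IsInvertibleObj X)
    (hY : IsInvertibleObj Y) (f : X ≅ Y) :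
    f.hom ≫ invertibleDoubleDual hY =
      invertibleDoubleDual hX ≫ rightAdjointMate (rightAdjointMate f.hom) := by
  have h : invertibleDoubleDual hX =
      f.hom ≫ invertibleDoubleDual hY ≫ rightAdjointMate (rightAdjointMate f.inv) := by
    apply invertible_doubleDual_ext hX
    rw [trace_conj, coevaluation_invertibleDoubleDual, f.inv_hom_id_assoc,
      coevaluation_invertibleDoubleDual]
  rw [h, Category.assoc, Category.assoc, ← comp_rightAdjointMate, ← comp_rightAdjointMate]
  simp

/-- It suffices to compare traces. The trace over `X ⊗ Y` is a loop for `Y` inside a loop for `X`;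
each collapses to the identity in turn. -/
lemma invertibleDoubleDual_tensor {X Y : C} (hX : IsInvertibleObj X)
    (hY : IsInvertibleObj Y) (hXY : IsInvertibleObj (X ⊗ Y)) :
    (invertibleDoubleDual hX ⊗ₘ invertibleDoubleDual hY) ≫ doubleDualTensor X Y =
      invertibleDoubleDual hXY := by
  apply invertible_doubleDual_ext hXY
  rw [coevaluation_invertibleDoubleDual, comp_whiskerRight, Category.assoc,
    doubleDualTensor_comp_evaluation, ← whisker_exchange_assoc]
  have h1 : η_ (X ⊗ Y) (dual (X ⊗ Y)) ≫ (X ⊗ Y) ◁ (rightDualTensorIso X Y).hom =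
    η_ (X ⊗ Y) (dual Y ⊗ dual X) := coevaluation_comp_rightDualIso_hom _ _
  rw [reassoc_of% h1, tensor_comp_evaluation, ExactPairing.tensor_coevaluation]
  calc
    _ = η_ X (dual X) ⊗≫ X ◁ (η_ Y (dual Y) ≫ invertibleDoubleDual hY ▷ dual Y ≫
          ε_ (dual Y) (dual (dual Y))) ▷ dual X ⊗≫
          invertibleDoubleDual hX ▷ dual X ≫ ε_ (dual X) (dual (dual X)) := by
      monoidal
    _ = η_ X (dual X) ≫ invertibleDoubleDual hX ▷ dual X ≫ ε_ (dual X) (dual (dual X)) := by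
      rw [coevaluation_invertibleDoubleDual]; monoidal
    _ = _ := coevaluation_invertibleDoubleDual hX

/-- The canonical map is normalised by its left trace. This identity controls the other side: it
yields that the right trace of the identity is also `1`, and that the canonical map is invertible.
-/
lemma evaluation_comp_coevaluation {X : C} (h : IsInvertibleObj X) :
    ε_ X (dual X) ≫ η_ (dual X) (dual (dual X)) = dual X ◁ invertibleDoubleDual h := by
  have := h.isIso_coevaluation (Y := dual X)
  -- The zigzag identity, solved for the inverse of the coevaluation.
  have h1 : dual X ◁ inv (η_ X (dual X)) = 
      (α_ _ _ _).inv ≫ ε_ X (dual X) ▷ dual X ≫ (λ_ _).hom ≫ (ρ_ _).inv := by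
    rw [← cancel_epi (dual X ◁ η_ X (dual X)), ← MonoidalCategory.whiskerLeft_comp]
    simp
  symm
  calc
    _ = 𝟙 _ ⊗≫ (dual X ⊗ X) ◁ η_ (dual X) (dual (dual X)) ⊗≫
          (dual X ◁ inv (η_ X (dual X))) ▷ dual (dual X) ⊗≫ 𝟙 _ := by
      rw [invertibleDoubleDual]; dsimp [tensorRightHomEquiv]; monoidal
    _ = 𝟙 _ ⊗≫ ((dual X ⊗ X) ◁ η_ (dual X) (dual (dual X)) ≫
          ε_ X (dual X) ▷ (dual X ⊗ dual (dual X))) ⊗≫ 𝟙 _ := by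
      rw [h1]; monoidal
    _ = _ := by
      rw [whisker_exchange]; monoidal

lemma isIso_invertibleDoubleDual {X : C} (h : IsInvertibleObj X) :
    IsIso (invertibleDoubleDual h) := by
  have := h.isIso_evaluation (Y := dual X)
  have := h.dual.isIso_coevaluation (Y := dual (dual X))
  have := h.dual.isEquivalence_tensorLeft
  have h1 : IsIso ((tensorLeft (dual X)).map (invertibleDoubleDual h)) := by
    change IsIso (dual X ◁ invertibleDoubleDual h)
    rw [← evaluation_comp_coevaluation]
    infer_instance
  exact isIso_of_reflects_iso _ (tensorLeft (dual X))

namespace PivotalStructure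

variable (φ : PivotalStructure C)

lemma leftTrace_comm {X Y : C} (p : X ⟶ Y) (g : Y ⟶ X) :
    φ.leftTrace (p ≫ g) = φ.leftTrace (g ≫ p) := by
  rw [leftTrace, leftTrace, Category.assoc, φ.naturality, trace_conj, Category.assoc]

lemma rightTrace_comm {X Y : C} (p : X ⟶ Y) (g : Y ⟶ X) :
    φ.rightTrace (p ≫ g) = φ.rightTrace (g ≫ p) := by
  have h : (φ.iso X).inv ≫ p = rightAdjointMate (rightAdjointMate p) ≫ (φ.iso Y).inv := by
    rw [Iso.inv_comp_eq, ← Category.assoc, ← φ.naturality, Category.assoc, Iso.hom_inv_id,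
      Category.comp_id]
  have h' : (φ.iso Y).inv ≫ g = rightAdjointMate (rightAdjointMate g) ≫ (φ.iso X).inv := by
    rw [Iso.inv_comp_eq, ← Category.assoc, ← φ.naturality, Category.assoc, Iso.hom_inv_id,
      Category.comp_id]
  have hg := coevaluation_comp_rightAdjointMate_assoc (rightAdjointMate g)
    (dual Y ◁ (rightAdjointMate (rightAdjointMate p) ≫ (φ.iso Y).inv) ≫ ε_ Y (dual Y))
  rw [rightTrace, rightTrace, reassoc_of% h, reassoc_of% h', h]
  rw [MonoidalCategory.whiskerLeft_comp_assoc (dual Y) (rightAdjointMate (rightAdjointMate g)), hg,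
    ← whisker_exchange_assoc, rightAdjointMate_comp_evaluation]
  simp

variable [Preadditive C] [MonoidalPreadditive C]

lemma leftTrace_sum {X : C} {J : Type} [Fintype J] (f : J → (X ⟶ X)) :
    φ.leftTrace (∑ k, f k) = ∑ k, φ.leftTrace (f k) := by
  simp [leftTrace, Preadditive.sum_comp, Preadditive.comp_sum, sum_whiskerRight]

lemma rightTrace_sum {X : C} {J : Type} [Fintype J] (f : J → (X ⟶ X)) :
    φ.rightTrace (∑ k, f k) = ∑ k, φ.rightTrace (f k) := by
  simp [rightTrace, Preadditive.sum_comp, Preadditive.comp_sum, whiskerLeft_sum]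

variable [Linear ℂ C] [MonoidalLinear ℂ C]

lemma leftTrace_smul {X : C} (c : ℂ) (f : X ⟶ X) :
    φ.leftTrace (c • f) = c • φ.leftTrace f := by
  simp [leftTrace]

lemma rightTrace_smul {X : C} (c : ℂ) (f : X ⟶ X) :
    φ.rightTrace (c • f) = c • φ.rightTrace f := by
  simp [rightTrace]

end PivotalStructure

variable [Abelian C] [Linear ℂ C] [MonoidalPreadditive C] [MonoidalLinear ℂ C] [IsFusion C]

/-- The canonical maps of simple objects extend to all objects by semisimplicity. Compatibility with
`⊗` is an equality of natural transformations between biadditive functors, so it need only be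
checked on simple objects. -/
lemma exists_pivotal (h : IsPointed C) :
    ∃ φ : PivotalStructure C, ∀ (S : C) [Simple S],
      (φ.iso S).hom = invertibleDoubleDual (h S inferInstance) := by
  obtain ⟨α, hα⟩ := exists_natTrans_of_isSumOf (isSumOf_simple (C := C)) (F := 𝟭 C)
    (G := doubleDual C) (fun S (hS : Simple S) => invertibleDoubleDual (h S hS))
    fun S T hS hT f => by
      by_cases hf : f = 0
      · subst hf; exact zero_comp.trans ((congrArg _ (Functor.map_zero _ _ _)).trans comp_zero).symm
      · have := isIso_of_hom_simple hf
        exact invertibleDoubleDual_naturality _ _ (asIso f)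
  have hiso : ∀ X, IsIso (α.app X) := fun X => isIso_app_of_isSumOf α
    (fun S (hS : Simple S) => by rw [hα S hS]; exact isIso_invertibleDoubleDual _)
    (isSumOf_simple X)
  let a : ∀ X : C, X ⟶ dual (dual X) := fun X => α.app X
  have hα' : ∀ {X X' Y Y' : C} (f : X ⟶ X') (g : Y ⟶ Y'),
      (f ⊗ₘ g) ≫ (a X' ⊗ₘ a Y') ≫ doubleDualTensor X' Y' =
        ((a X ⊗ₘ a Y) ≫ doubleDualTensor X Y) ≫
          rightAdjointMate (rightAdjointMate (f ⊗ₘ g)) := by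
    intro X X' Y Y' f g
    have hf : f ≫ a X' = a X ≫ rightAdjointMate (rightAdjointMate f) := α.naturality f
    have hg : g ≫ a Y' = a Y ≫ rightAdjointMate (rightAdjointMate g) := α.naturality g
    rw [← Category.assoc, tensorHom_comp_tensorHom, hf, hg, ← tensorHom_comp_tensorHom,
      Category.assoc, doubleDualTensor_naturality, Category.assoc]
  let γ : curriedTensor C ⟶ curriedTensor C ⋙ (Functor.whiskeringRight C C C).obj (doubleDual C) :=
    { app X := { app Y := (a X ⊗ₘ a Y) ≫ doubleDualTensor X Y
                 naturality Y Y' f := by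
                  have := hα' (𝟙 X) f
                  rw [id_tensorHom] at this
                  exact this }
      naturality X X' f := by
        ext Y
        have := hα' f (𝟙 Y)
        rw [tensorHom_id] at this
        exact this }
  let δ : curriedTensor C ⟶ curriedTensor C ⋙ (Functor.whiskeringRight C C C).obj (doubleDual C) :=
    { app X := { app Y := α.app (X ⊗ Y)
                 naturality Y Y' f := α.naturality (X ◁ f) }
      naturality X X' f := by ext Y; exact α.naturality (f ▷ Y) }
  have : ∀ X, ((curriedTensor C).obj X).Additive := fun X =>
    inferInstanceAs (tensorLeft X).Additive
  have : ∀ X, ((curriedTensor C).flip.obj X).Additive := fun X =>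
    inferInstanceAs (tensorRight X).Additive
  have hγδ : γ = δ := tensor_natural_ext fun S T hS hT => by
    have := (h S inferInstance).simple_tensor T
    change (α.app S ⊗ₘ α.app T) ≫ doubleDualTensor S T = α.app (S ⊗ T)
    rw [hα S hS, hα T hT, hα _ this]
    exact invertibleDoubleDual_tensor _ _ _
  exact ⟨{  iso X := @asIso _ _ _ _ (α.app X) (hiso X)
            naturality f := α.naturality f
            tensor X Y := congrArg (fun γ => (γ.app X).app Y) hγδ }, fun S hS => hα S hS⟩


/-- A pointed fusion category admits a spherical structure. -/
theorem nonempty_sphericalStructure (h : IsPointed C) : Nonempty (SphericalStructure C) := by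
  obtain ⟨φ, hφ⟩ := exists_pivotal h
  have hl : ∀ (S : C) [Simple S], φ.leftTrace (𝟙 S) = 𝟙 _ := fun S _ => by
    rw [PivotalStructure.leftTrace, Category.id_comp, hφ, coevaluation_invertibleDoubleDual]
  have hr : ∀ (S : C) [Simple S], φ.rightTrace (𝟙 S) = 𝟙 _ := fun S _ => by
    have hS := h S inferInstance
    have := hS.isIso_evaluation (Y := dual S)
    -- Precomposing with the invertible evaluation turns the coevaluation of the dual into `dual S ◁
    -- φ`, which cancels the `φ⁻¹` of the trace.
    rw [PivotalStructure.rightTrace, Category.comp_id, ← cancel_epi (ε_ S (dual S)),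
      ← Category.assoc, evaluation_comp_coevaluation hS, ← hφ S,
      ← MonoidalCategory.whiskerLeft_comp_assoc]
    simp
  refine ⟨⟨φ, fun {X} f => ?_⟩⟩
  obtain ⟨J, _, S, i, p, hS, htot⟩ := (isSumOf_simple X).exists_total
  -- By cyclicity each term can be traced on the simple object `S k`, where the endomorphism is a
  -- scalar and both traces of the identity are `1`.
  have hf : f = ∑ k, p k ≫ i k ≫ f := by
    refine (Category.id_comp f).symm.trans ?_
    rw [← htot, Preadditive.sum_comp]
    simp only [Category.assoc]
  rw [hf, φ.leftTrace_sum, φ.rightTrace_sum]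
  refine Finset.sum_congr rfl fun k _ => ?_
  rw [φ.leftTrace_comm, φ.rightTrace_comm]
  have : Simple (S k) := hS k
  obtain ⟨c, hc⟩ := exists_smul_id ((i k ≫ f) ≫ p k)
  rw [hc, φ.leftTrace_smul, φ.rightTrace_smul, hl, hr]

end Spherical

/-! ### Simple objects of the Müger centre -/

section Transparent

variable {C : Type u} [Category.{v} C] [MonoidalCategory C] [BraidedCategory C]

lemma doubleBraiding_naturality_right (X : C) {Y Z : C} (f : Y ⟶ Z) :
    X ◁ f ≫ (β_ X Z).hom ≫ (β_ Z X).hom = (β_ X Y).hom ≫ (β_ Y X).hom ≫ X ◁ f := by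
  rw [BraidedCategory.braiding_naturality_right_assoc, BraidedCategory.braiding_naturality_left]

lemma doubleBraiding_naturality_left {X Y : C} (f : X ⟶ Y) (Z : C) :
    f ▷ Z ≫ (β_ Y Z).hom ≫ (β_ Z Y).hom = (β_ X Z).hom ≫ (β_ Z X).hom ≫ f ▷ Z := by
  rw [BraidedCategory.braiding_naturality_left_assoc, BraidedCategory.braiding_naturality_right]

lemma isTransparent_of_retract {S Y : C} (hY : isTransparent C Y) (i : S ⟶ Y) (p : Y ⟶ S)
    (h : i ≫ p = 𝟙 S) : isTransparent C S := by
  intro X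
  have h1 : (β_ X S).hom ≫ (β_ S X).hom ≫ X ◁ i = X ◁ i := by
    rw [← doubleBraiding_naturality_right, hY, Category.comp_id]
  calc (β_ X S).hom ≫ (β_ S X).hom = ((β_ X S).hom ≫ (β_ S X).hom ≫ X ◁ i) ≫ X ◁ p := by
        simp [← MonoidalCategory.whiskerLeft_comp, h]
    _ = 𝟙 _ := by rw [h1, ← MonoidalCategory.whiskerLeft_comp, h, MonoidalCategory.whiskerLeft_id]

lemma isTransparent_of_iso {S Y : C} (hY : isTransparent C Y) (e : S ≅ Y) : isTransparent C S :=
  isTransparent_of_retract hY e.hom e.inv e.hom_inv_id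

lemma isTransparent_of_total [Preadditive C] [MonoidalPreadditive C] {X : C} {J : Type}
    [Fintype J] {S : J → C} (hS : ∀ k, isTransparent C (S k)) (i : ∀ k, S k ⟶ X)
    (p : ∀ k, X ⟶ S k) (h : ∑ k, p k ≫ i k = 𝟙 X) : isTransparent C X := by
  intro Z
  have h1 : ∀ k, (β_ Z X).hom ≫ (β_ X Z).hom ≫ Z ◁ (p k ≫ i k) = Z ◁ (p k ≫ i k) := by
    intro k
    rw [MonoidalCategory.whiskerLeft_comp, ← Category.assoc (β_ X Z).hom, ← Category.assoc,
      ← doubleBraiding_naturality_right, hS, Category.comp_id]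
  have h2 : (β_ Z X).hom ≫ (β_ X Z).hom ≫ Z ◁ (∑ k, p k ≫ i k) = Z ◁ (∑ k, p k ≫ i k) := by
    simp only [whiskerLeft_sum, Preadditive.comp_sum, h1]
  simpa [h] using h2

end Transparent

section MugerCenter

variable {C : Type u} [Category.{v} C] [Abelian C] [Linear ℂ C] [MonoidalCategory C]
  [MonoidalPreadditive C] [MonoidalLinear ℂ C] [RigidCategory C] [BraidedCategory C] [IsFusion C]

/-- Given a nonzero monomorphism `f` to `Y` in the centre, some simple summand of the source is
carried isomorphically to `Y.obj`. This provides a section of `f`, and a split epimorphism that is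
mono is an isomorphism. -/
lemma simple_of_simple_obj (Y : MugerCenter C) [Simple Y.obj] : Simple Y where
  mono_isIso_iff_nonzero {Z} f _ := by
    constructor
    · rintro _ rfl
      refine id_nonzero Y.obj ?_
      have h : 𝟙 Y = 0 := by rw [← IsIso.inv_hom_id (0 : Z ⟶ Y), comp_zero]
      exact congrArg (fun g => g.hom) h
    · intro hf
      have hf' : f.hom ≠ 0 := fun h => hf (ObjectProperty.hom_ext _ h)
      obtain ⟨J, _, S, i, p, hS, htot⟩ := (isSumOf_simple Z.obj).exists_total
      obtain ⟨k, hk⟩ : ∃ k, i k ≫ f.hom ≠ 0 := by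
        by_contra! h
        refine hf' ?_
        rw [← Category.id_comp f.hom, ← htot, Preadditive.sum_comp]
        simp [h]
      have := hS k
      have := isIso_of_hom_simple hk
      let g : Y ⟶ Z := ObjectProperty.homMk (inv (i k ≫ f.hom) ≫ i k)
      have hg : g ≫ f = 𝟙 Y := ObjectProperty.hom_ext _ (by simp [g])
      exact ⟨g, by rw [← cancel_mono f]; simp [hg], hg⟩

/-- A simple summand of a transparent object is transparent, so its inclusion is a nonzero split
monomorphism of the centre, hence an isomorphism onto `Y`. -/
lemma simple_obj_of_simple (Y : MugerCenter C) [Simple Y] : Simple Y.obj := by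
  obtain ⟨J, _, _, S, i, p, hS, horth, htot⟩ := isSumOf_simple Y.obj
  obtain ⟨k⟩ : Nonempty J := by
    by_contra h
    rw [not_nonempty_iff] at h
    refine id_nonzero Y (ObjectProperty.hom_ext _ ?_)
    simpa using htot.symm
  have hk : i k ≫ p k = 𝟙 (S k) := by simp [horth]
  let Z : MugerCenter C := ⟨S k, isTransparent_of_retract Y.2 (i k) (p k) hk⟩
  let i' : Z ⟶ Y := ObjectProperty.homMk (i k)
  let p' : Y ⟶ Z := ObjectProperty.homMk (p k)
  have hk' : i' ≫ p' = 𝟙 Z := ObjectProperty.hom_ext _ hk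
  have : Mono i' := mono_of_mono_fac hk'
  have := hS k
  have hne : i' ≠ 0 := by
    intro h
    refine id_nonzero (S k) ?_
    have := hk'.symm.trans (by rw [h, zero_comp])
    exact congrArg (fun g => g.hom) this
  have := isIso_of_mono_of_nonzero hne
  let e : Y.obj ≅ S k := ((isTransparent C).ι.mapIso (asIso i')).symm
  exact Simple.of_iso e

/-- A braided fusion category is non-degenerate if its only simple transparent object is the
unit. -/
lemma isNondegenerate_of_forall_simple
    (h : ∀ S : C, Simple S → isTransparent C S → Nonempty (S ≅ 𝟙_ C)) : IsNondegenerate C := by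
  have := Abelian.hasFiniteBiproducts (C := C)
  refine IsUnitGenerated.braidedEquivalent
    { unit_ne_zero := fun h => id_nonzero (𝟙_ C) (congrArg (fun g => g.hom) h)
      smul_id := fun f => ?_
      total := fun X => ?_
      sum := fun n => ?_ }
  · obtain ⟨c, hc⟩ := exists_smul_id (X := 𝟙_ C) f.hom
    exact ⟨c, ObjectProperty.hom_ext _ hc⟩
  · obtain ⟨J, _, _, S, i, p, hS, horth, htot⟩ := isSumOf_simple X.obj
    have e : ∀ k, S k ≅ 𝟙_ C := fun k => (h (S k) (hS k)
      (isTransparent_of_retract X.2 (i k) (p k) (by simp [horth]))).some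
    let ε := (Fintype.equivFin J).symm
    refine ⟨Fintype.card J, fun k => ObjectProperty.homMk ((e (ε k)).inv ≫ i (ε k)),
      fun k => ObjectProperty.homMk (p (ε k) ≫ (e (ε k)).hom), ?_⟩
    apply ObjectProperty.hom_ext
    refine Eq.trans ?_ htot
    refine ((isTransparent C).ι.map_sum _ _).trans ?_
    refine Eq.trans ?_ (ε.sum_comp fun k => p k ≫ i k)
    simp
  · let S : Fin n → C := fun _ => 𝟙_ C
    let X : MugerCenter C := ⟨⨁ S, isTransparent_of_total (S := S)
      (fun _ => (𝟙_ (MugerCenter C)).2) (biproduct.ι S) (biproduct.π S) biproduct.total⟩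
    refine ⟨X, fun k => ObjectProperty.homMk (biproduct.ι S k),
      fun k => ObjectProperty.homMk (biproduct.π S k), fun k l => ?_, ?_⟩
    · apply ObjectProperty.hom_ext
      split_ifs with hkl
      · subst hkl; exact biproduct.ι_π_self S k
      · exact biproduct.ι_π_ne S hkl
    · apply ObjectProperty.hom_ext
      refine Eq.trans ?_ (biproduct.total (f := S))
      exact (isTransparent C).ι.map_sum _ _

end MugerCenter

/-! ### Objects with an involution -/

section Involution

lemma zmod_two_eq_one_or (g : Multiplicative (ZMod 2)) : g = 1 ∨ g = Multiplicative.ofAdd 1 := by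
  revert g; decide

/-- The action of `ℤ/2ℤ` defined by an involution. -/
def involutionHom {M : Type*} [Monoid M] (s : M) (hs : s * s = 1) :
    Multiplicative (ZMod 2) →* M where
  toFun g := if g = 1 then 1 else s
  map_one' := by simp
  map_mul' g h := by
    have h2 : Multiplicative.ofAdd (1 : ZMod 2) * Multiplicative.ofAdd 1 = 1 := by decide
    have h1 : Multiplicative.ofAdd (1 : ZMod 2) ≠ 1 := by decide
    rcases zmod_two_eq_one_or g with rfl | rfl <;> rcases zmod_two_eq_one_or h with rfl | rfl
    · simp
    · simp
    · simp
    · simp only [h2, h1, if_true, if_false, hs]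

lemma involutionHom_ofAdd_one {M : Type*} [Monoid M] (s : M) (hs : s * s = 1) :
    involutionHom s hs (Multiplicative.ofAdd 1) = s := by
  change (if Multiplicative.ofAdd (1 : ZMod 2) = 1 then 1 else s) = s
  exact if_neg (by decide)

variable {C : Type u} [Category.{v} C]

/-- An object with an involution, as an action of `ℤ/2ℤ`. -/
abbrev involutive (X : C) (s : X ⟶ X) (hs : s ≫ s = 𝟙 X) : Action C (Multiplicative (ZMod 2)) where
  V := X
  ρ := involutionHom (M := End X) s hs

/-- The action of the generator. -/
abbrev actionGen (X : Action C (Multiplicative (ZMod 2))) : X.V ⟶ X.V :=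
  X.ρ (Multiplicative.ofAdd 1)

lemma actionGen_involutive (X : C) (s : X ⟶ X) (hs : s ≫ s = 𝟙 X) :
    actionGen (involutive X s hs) = s :=
  involutionHom_ofAdd_one (M := End X) s hs

lemma actionGen_sq (X : Action C (Multiplicative (ZMod 2))) :
    actionGen X ≫ actionGen X = 𝟙 X.V := by
  change X.ρ _ * X.ρ _ = 1
  rw [← map_mul, ← map_one X.ρ]; rfl

/-- A morphism commuting with the generator is equivariant. -/
@[simps]
def actionHomMk {X Y : Action C (Multiplicative (ZMod 2))} (f : X.V ⟶ Y.V)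
    (h : actionGen X ≫ f = f ≫ actionGen Y) : X ⟶ Y where
  hom := f
  comm g := by
    rcases zmod_two_eq_one_or g with rfl | rfl
    · simp
    · exact h

end Involution

/-! ### The two simple super vector spaces -/

namespace RepZ2

/-- The odd line. -/
def oddLine : RepZ2 := involutive (𝟙_ (FGModuleCat.{0} ℂ)) (-𝟙 _) (by simp)

lemma parity_oddLine : parity oddLine = -𝟙 oddLine := by
  ext1
  exact actionGen_involutive _ _ _

/-- With both parities equal to `-1`, the sign operator is `(1 - 1 - 1 - 1) / 2 = -1`, and the
ordinary swap of a line with itself is trivial. -/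
lemma superSwap_oddLine : (superSwap oddLine oddLine).hom = -𝟙 (oddLine ⊗ oddLine) := by
  have h1 : sgn oddLine oddLine = -𝟙 (oddLine ⊗ oddLine) := by
    have h1 : (-𝟙 oddLine) ▷ oddLine = -𝟙 _ := by
      rw [← id_whiskerRight]; exact (tensorRight oddLine).map_neg
    have h2 : oddLine ◁ (-𝟙 oddLine) = -𝟙 _ := by
      rw [← MonoidalCategory.whiskerLeft_id]; exact (tensorLeft oddLine).map_neg
    rw [sgn, parity_oddLine, MonoidalCategory.tensorHom_def, h1, h2, Preadditive.neg_comp,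
      Category.id_comp]
    module
  have h2 : (β_ oddLine oddLine).hom = 𝟙 (oddLine ⊗ oddLine) := by
    ext1
    change (β_ (𝟙_ (FGModuleCat.{0} ℂ)) (𝟙_ _)).hom = 𝟙 _
    rw [braiding_tensorUnit_left, unitors_equal, Iso.hom_inv_id]
  change sgn oddLine oddLine ≫ (β_ oddLine oddLine).hom = _
  rw [h1, h2, Category.comp_id]

lemma exists_smul_id_oddLine (f : oddLine ⟶ oddLine) : ∃ c : ℂ, f = c • 𝟙 oddLine := by
  let l : ℂ →ₗ[ℂ] ℂ := f.hom.hom.hom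
  refine ⟨l 1, ?_⟩
  ext1
  apply ObjectProperty.hom_ext
  apply ModuleCat.hom_ext
  change l = l 1 • LinearMap.id
  ext
  simp

lemma exists_unit_comp_ne_zero {V W : FGModuleCat.{0} ℂ} {g : V ⟶ W} (hg : g ≠ 0) :
    ∃ a : 𝟙_ (FGModuleCat.{0} ℂ) ⟶ V, a ≫ g ≠ 0 := by
  by_contra! h
  refine hg ?_
  apply ObjectProperty.hom_ext
  apply ModuleCat.hom_ext
  refine LinearMap.ext fun v => ?_
  have h1 := h (ObjectProperty.homMk (ModuleCat.ofHom (LinearMap.toSpanSingleton ℂ V v)))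
  have h2 := congrArg (fun f => f.hom.hom (1 : ℂ)) h1
  change g.hom.hom (LinearMap.toSpanSingleton ℂ V v 1) = 0 at h2
  simpa using h2

/-- One of `1 + p` and `1 - p`, with `p` the parity, is nonzero since they sum to `2`. Their images
consist of even and odd vectors respectively. -/
lemma exists_ne_zero_of_line (V : RepZ2) (hV : 𝟙 V ≠ 0) :
    (∃ f : 𝟙_ RepZ2 ⟶ V, f ≠ 0) ∨ ∃ f : oddLine ⟶ V, f ≠ 0 := by
  have hp : actionGen V ≫ actionGen V = 𝟙 V.V := actionGen_sq V
  by_cases h : 𝟙 V.V + actionGen V = 0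
  · have h' : 𝟙 V.V - actionGen V ≠ 0 := by
      intro h'
      refine hV ?_
      ext1
      have : (2 : ℂ) • 𝟙 V.V = 0 := by
        calc (2 : ℂ) • 𝟙 V.V = (𝟙 V.V + actionGen V) + (𝟙 V.V - actionGen V) := by
              rw [two_smul]; abel
          _ = 0 := by rw [h, h', add_zero]
      exact (smul_eq_zero.1 this).resolve_left two_ne_zero
    obtain ⟨a, ha⟩ := exists_unit_comp_ne_zero h'
    refine Or.inr ⟨actionHomMk (a ≫ (𝟙 V.V - actionGen V)) ?_, fun h0 => ha ?_⟩
    · have h1 : -(a ≫ (𝟙 V.V - actionGen V)) = (a ≫ (𝟙 V.V - actionGen V)) ≫ actionGen V := by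
        simp only [Preadditive.comp_sub, Preadditive.sub_comp, Category.assoc, hp,
          Category.comp_id]
        abel
      have h2 : actionGen oddLine = -𝟙 _ := actionGen_involutive _ _ _
      rw [h2]
      refine Eq.trans ?_ h1
      exact (Preadditive.neg_comp _ _).trans (congrArg _ (Category.id_comp _))
    · exact congrArg (fun f => f.hom) h0
  · obtain ⟨a, ha⟩ := exists_unit_comp_ne_zero h
    refine Or.inl ⟨actionHomMk (a ≫ (𝟙 V.V + actionGen V)) ?_, fun h0 => ha ?_⟩
    · have : actionGen (𝟙_ RepZ2) = 𝟙 _ := rfl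
      rw [this]
      simp only [Preadditive.comp_add, Preadditive.add_comp, Category.assoc,
        hp, Category.comp_id, Category.id_comp]
      abel
    · exact congrArg (fun f => f.hom) h0

end RepZ2

/-! ### The fermion of a slightly degenerate category -/

section Fermion

variable {C : Type u} [Category.{v} C] [Abelian C] [Linear ℂ C] [MonoidalCategory C]
  [MonoidalPreadditive C] [MonoidalLinear ℂ C] [RigidCategory C] [IsFusion C]

lemma braiding_self_eq_neg_of_iso {D : Type u'} [Category.{v'} D] [Preadditive D]
    [MonoidalCategory D] [BraidedCategory D] {X Y : D} (e : X ≅ Y)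
    (h : (β_ Y Y).hom = -𝟙 (Y ⊗ Y)) : (β_ X X).hom = -𝟙 (X ⊗ X) := by
  have h3 := BraidedCategory.braiding_naturality e.hom e.hom
  rw [h, Preadditive.comp_neg, Category.comp_id] at h3
  rw [← cancel_mono (e.hom ⊗ₘ e.hom), ← h3, Preadditive.neg_comp, Category.id_comp]

/-- The projector onto a simple summand is a scalar, necessarily `1`, so the summand is everything.
-/
lemma simple_of_endomorphisms {X : C} (hX : 𝟙 X ≠ 0) (h : ∀ f : X ⟶ X, ∃ c : ℂ, f = c • 𝟙 X) :
    Simple X := by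
  obtain ⟨J, _, _, S, i, p, hS, horth, htot⟩ := isSumOf_simple X
  obtain ⟨k⟩ : Nonempty J := by
    by_contra h
    rw [not_nonempty_iff] at h
    exact hX (by simpa using htot.symm)
  have hk : i k ≫ p k = 𝟙 (S k) := by simp [horth]
  have := hS k
  obtain ⟨c, hc⟩ := h (p k ≫ i k)
  have hc1 : (c - 1) • 𝟙 (S k) = 0 := by
    have h1 : i k ≫ (p k ≫ i k) ≫ p k = 𝟙 (S k) := by
      rw [Category.assoc, hk, Category.comp_id, hk]
    rw [hc, Linear.smul_comp, Category.id_comp, Linear.comp_smul, hk] at h1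
    rw [sub_smul, h1, one_smul, sub_self]
  rw [sub_eq_zero.1 ((smul_eq_zero.1 hc1).resolve_right (id_nonzero _)), one_smul] at hc
  exact Simple.of_iso (Y := S k) ⟨p k, i k, hc, hk⟩

variable [BraidedCategory C]

/-- The fermion is a preimage of the odd line: it is simple because its endomorphisms are scalars,
and the braided equivalence transports the self-braiding `-1`. The image of any other simple
transparent object receives a nonzero map from the unit or the odd line, and Schur's lemma applies
in `C`. -/
lemma exists_fermion (hdeg : IsSlightlyDegenerate C) :
    ∃ (f : C) (_ : Simple f), isTransparent C f ∧ (β_ f f).hom = -𝟙 (f ⊗ f) ∧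
      ∀ S : C, Simple S → isTransparent C S → Nonempty (S ≅ 𝟙_ C) ∨ Nonempty (S ≅ f) := by
  obtain ⟨F, _, _, _, _⟩ := hdeg
  let o : SVec := RepZ2.oddLine
  let Y : MugerCenter C := F.objPreimage o
  let e : F.obj Y ≅ o := F.objObjPreimageIso o
  have hY : 𝟙 Y ≠ 0 := by
    intro h
    have h1 : 𝟙 (F.obj Y) = 0 := by rw [← F.map_id, h, F.map_zero]
    have h2 : 𝟙 o = 0 := by
      rw [← e.inv_hom_id, ← Category.id_comp e.hom, h1, zero_comp, comp_zero]
    have h3 : (LinearMap.id : ℂ →ₗ[ℂ] ℂ) = 0 := congrArg (fun g => g.hom.hom.hom) h2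
    exact one_ne_zero (congrArg (fun g => g 1) h3)
  have hend : ∀ g : Y ⟶ Y, ∃ c : ℂ, g = c • 𝟙 Y := by
    intro g
    obtain ⟨c, hc⟩ := RepZ2.exists_smul_id_oddLine (e.inv ≫ F.map g ≫ e.hom)
    refine ⟨c, F.map_injective ?_⟩
    have h1 : e.inv ≫ F.map g ≫ e.hom = c • 𝟙 o := hc
    have h2 : F.map g = e.hom ≫ (e.inv ≫ F.map g ≫ e.hom) ≫ e.inv := by simp
    rw [h2, h1, F.map_smul, F.map_id]
    simp
  have hs : Simple Y.obj := simple_of_endomorphisms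
    (fun h => hY (ObjectProperty.hom_ext _ h)) fun g => by
      obtain ⟨c, hc⟩ := hend (ObjectProperty.homMk g)
      exact ⟨c, congrArg (fun h => h.hom) hc⟩
  have hβ : (β_ Y Y).hom = -𝟙 (Y ⊗ Y) := by
    refine F.map_injective ?_
    have h1 : (β_ (F.obj Y) (F.obj Y)).hom = -𝟙 _ :=
      braiding_self_eq_neg_of_iso e RepZ2.superSwap_oddLine
    rw [Functor.map_braiding, h1, Preadditive.neg_comp, Category.id_comp, Preadditive.comp_neg,
      Functor.Monoidal.δ_μ, F.map_neg, F.map_id]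
  refine ⟨Y.obj, hs, Y.2, congrArg (fun g => g.hom) hβ, fun S hS hS' => ?_⟩
  let S' : MugerCenter C := ⟨S, hS'⟩
  have hFS : 𝟙 (F.obj S') ≠ 0 := by
    intro h
    refine id_nonzero S (congrArg (fun g => g.hom) (?_ : 𝟙 S' = 0))
    exact F.map_injective (by rw [F.map_id, h, F.map_zero])
  have key : ∀ (Z : MugerCenter C) [Simple Z.obj] (g : F.obj Z ⟶ F.obj S'), g ≠ 0 →
      Nonempty (S ≅ Z.obj) := by
    intro Z _ g hg
    obtain ⟨g', rfl⟩ := F.map_surjective g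
    have hg' : g'.hom ≠ 0 := by
      intro h
      have h' : g' = 0 := ObjectProperty.hom_ext _ h
      exact hg (by rw [h', F.map_zero])
    have := isIso_of_hom_simple (X := Z.obj) (Y := S) hg'
    exact ⟨(asIso (X := Z.obj) (Y := S) g'.hom).symm⟩
  rcases RepZ2.exists_ne_zero_of_line (F.obj S') hFS with ⟨g, hg⟩ | ⟨g, hg⟩
  · left
    have : Simple (𝟙_ (MugerCenter C)).obj := IsFusion.simple_tensorUnit (C := C)
    let e' : 𝟙_ SVec ≅ F.obj (𝟙_ (MugerCenter C)) := Functor.Monoidal.εIso F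
    let g' : 𝟙_ SVec ⟶ F.obj S' := g
    refine key (𝟙_ _) (e'.inv ≫ g') fun h => hg ?_
    have : g' = e'.hom ≫ e'.inv ≫ g' := by simp
    exact this.trans (by rw [h, comp_zero]; rfl)
  · right
    let g' : o ⟶ F.obj S' := g
    refine key Y (e.hom ≫ g') fun h => hg ?_
    have : g' = e.inv ≫ e.hom ≫ g' := by simp
    exact this.trans (by rw [h, comp_zero]; rfl)

/-- A transparent object with self-braiding `-1` is not the square of a simple object. -/
lemma not_square_of_braiding_eq_neg {f : C} (hf : (β_ f f).hom = -𝟙 (f ⊗ f))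
    (hf' : isTransparent C f) (S : C) [Simple S] [Simple (S ⊗ S)]
    [Simple (S ⊗ S ⊗ S)] [Simple ((S ⊗ S) ⊗ S ⊗ S)] (e : S ⊗ S ≅ f) : False := by
  obtain ⟨q, hq⟩ := exists_smul_id (β_ S S).hom
  have hr : (β_ S (S ⊗ S)).hom = (q * q) • (α_ S S S).inv := by
    rw [BraidedCategory.braiding_tensor_right_hom, hq]
    simp [smul_smul]
  have hl : (β_ (S ⊗ S) S).hom = (q * q) • (α_ S S S).hom := by
    rw [BraidedCategory.braiding_tensor_left_hom, hq]
    simp [smul_smul]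
  have h1 := braiding_self_eq_neg_of_iso e hf
  have h2 : (β_ (S ⊗ S) (S ⊗ S)).hom = ((q * q) * (q * q)) • 𝟙 _ := by
    rw [BraidedCategory.braiding_tensor_right_hom, hl]
    simp only [MonoidalLinear.smul_whiskerRight, MonoidalLinear.whiskerLeft_smul,
      Linear.smul_comp, Linear.comp_smul, smul_smul]
    congr 1
    monoidal
  -- Transparency makes the double braiding of `S` with `S ⊗ S` trivial, so `q ^ 4 = 1`; but `q ^ 4`
  -- is also the self-braiding of `S ⊗ S`, which is `-1`.
  have h3 : ((q * q) * (q * q)) • 𝟙 (S ⊗ S ⊗ S) = 𝟙 _ := by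
    have := isTransparent_of_iso hf' e S
    rw [hr, hl] at this
    simpa [smul_smul] using this
  have h4 : (q * q) * (q * q) = 1 := by
    have : ((q * q) * (q * q) - 1) • 𝟙 (S ⊗ S ⊗ S) = 0 := by rw [sub_smul, h3, one_smul, sub_self]
    exact sub_eq_zero.1 ((smul_eq_zero.1 this).resolve_right (id_nonzero _))
  rw [h1, h4, one_smul] at h2
  have : (2 : ℂ) • 𝟙 ((S ⊗ S) ⊗ S ⊗ S) = 0 := by
    rw [two_smul]; nth_rewrite 1 [← h2]; exact neg_add_cancel _
  exact id_nonzero _ ((smul_eq_zero.1 this).resolve_left two_ne_zero)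

end Fermion

/-! ### The dimension of the Müger centre -/

section MugerDimension

variable {C : Type u} [Category.{v} C] [Abelian C] [Linear ℂ C] [MonoidalCategory C]
  [MonoidalPreadditive C] [MonoidalLinear ℂ C] [RigidCategory C] [BraidedCategory C] [IsFusion C]

/-- Simplicity, Hom spaces and cancellation in the centre are all read off from the underlying
objects in `C`, so `FPdim_eq_card` applies without making the centre a fusion category. -/
lemma FPdim_mugerCenter_eq_card (hpt : IsPointed C) [Finite (Irr (MugerCenter C))] :
    FPdim (MugerCenter C) = Nat.card (Irr (MugerCenter C)) := by
  classical
  have hobj : ∀ i : Irr (MugerCenter C), Simple i.rep.obj := fun i => simple_obj_of_simple _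
  have hs : ∀ i j : Irr (MugerCenter C), Simple (i.rep ⊗ j.rep) := fun i j => by
    have : Simple (i.rep ⊗ j.rep).obj := (hpt i.rep.obj (hobj i)).simple_tensor j.rep.obj
    exact simple_of_simple_obj _
  refine FPdim_eq_card (fun i j => ?_) (fun i => Equiv.ofBijective
    (fun j => Irr.of (i.rep ⊗ j.rep))
    (Finite.injective_iff_bijective.1 fun j k hjk => ?_)) fun i j => ?_
  · have h : Module.finrank ℂ (i.rep ⟶ j.rep) = Module.finrank ℂ (i.rep.obj ⟶ j.rep.obj) :=
      LinearEquiv.finrank_eq InducedCategory.homLinearEquiv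
    rw [h, finrank_hom_simple_simple ℂ i.rep.obj j.rep.obj]
    have h' : i = j ↔ Nonempty (i.rep.obj ≅ j.rep.obj) := by
      rw [Irr.eq_iff]
      exact ⟨fun ⟨e⟩ => ⟨(isTransparent C).ι.mapIso e⟩, fun ⟨e⟩ => ⟨ObjectProperty.isoMk _ e⟩⟩
    simp only [h']
  · obtain ⟨e⟩ := Irr.of_eq_of_iff.1 hjk
    obtain ⟨e'⟩ := (hpt i.rep.obj (hobj i)).cancel_left ((isTransparent C).ι.mapIso e)
    exact Irr.eq_iff.2 ⟨ObjectProperty.isoMk _ e'⟩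
  · obtain ⟨e⟩ := Irr.nonempty_rep_of_iso (i.rep ⊗ j.rep)
    exact ⟨e.symm⟩

lemma FPdim_mugerCenter_eq_two (hpt : IsPointed C) {f : C} [Simple f] (hf : isTransparent C f)
    (hf1 : ¬ Nonempty (f ≅ 𝟙_ C))
    (hS : ∀ S : C, Simple S → isTransparent C S → Nonempty (S ≅ 𝟙_ C) ∨ Nonempty (S ≅ f)) :
    FPdim (MugerCenter C) = 2 := by
  let Y : MugerCenter C := ⟨f, hf⟩
  have : Simple Y.obj := inferInstanceAs (Simple f)
  have : Simple (𝟙_ (MugerCenter C)).obj := IsFusion.simple_tensorUnit (C := C)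
  have := simple_of_simple_obj Y
  have := simple_of_simple_obj (𝟙_ (MugerCenter C))
  have hcov : ∀ i : Irr (MugerCenter C), i = Irr.of Y ∨ i = Irr.of (𝟙_ _) := by
    intro i
    rw [← Irr.of_rep i, Irr.of_eq_of_iff, Irr.of_eq_of_iff]
    rcases hS i.rep.obj (simple_obj_of_simple _) i.rep.2 with ⟨⟨e⟩⟩ | ⟨⟨e⟩⟩
    · exact Or.inr ⟨ObjectProperty.isoMk _ e⟩
    · exact Or.inl ⟨ObjectProperty.isoMk _ e⟩
  have hne : Irr.of Y ≠ Irr.of (𝟙_ (MugerCenter C)) := by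
    intro h
    obtain ⟨e⟩ := Irr.of_eq_of_iff.1 h
    exact hf1 ⟨(isTransparent C).ι.mapIso e⟩
  have huniv : ({Irr.of Y, Irr.of (𝟙_ _)} : Set (Irr (MugerCenter C))) = Set.univ :=
    Set.eq_univ_of_forall hcov
  have : Finite (Irr (MugerCenter C)) := by
    rw [← Set.finite_univ_iff, ← huniv]
    exact Set.toFinite _
  rw [FPdim_mugerCenter_eq_card hpt, Nat.card_eq_two_iff.2 ⟨_, _, hne, huniv⟩]
  norm_num

/-- A transparent object with self-braiding `-1` is not isomorphic to the unit. -/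
lemma not_iso_unit_of_braiding_eq_neg {f : C} [Simple f] (hf : (β_ f f).hom = -𝟙 (f ⊗ f)) :
    ¬ Nonempty (f ≅ 𝟙_ C) := by
  rintro ⟨e⟩
  have h1 := braiding_self_eq_neg_of_iso e.symm hf
  have h2 : (β_ (𝟙_ C) (𝟙_ C)).hom = 𝟙 _ := by
    rw [braiding_tensorUnit_left, unitors_equal, Iso.hom_inv_id]
  have : Simple (𝟙_ C ⊗ 𝟙_ C) := Simple.of_iso (λ_ (𝟙_ C))
  have : (2 : ℂ) • 𝟙 (𝟙_ C ⊗ 𝟙_ C) = 0 := by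
    rw [two_smul]; nth_rewrite 1 [← h2]; rw [h1]; exact neg_add_cancel _
  exact id_nonzero _ ((smul_eq_zero.1 this).resolve_left two_ne_zero)

/-- A slightly degenerate pointed braided fusion category has a monoidal involution of the
identity functor acting by scalars on simple objects and by `-1` on the transparent fermion. -/
lemma exists_involution_of_isSlightlyDegenerate (hpt : IsPointed C) {f : C} [Simple f]
    (hf : (β_ f f).hom = -𝟙 (f ⊗ f)) (hf' : isTransparent C f) :
    ∃ θ : MonoidalInvolution C, θ.at f = -𝟙 f := by
  let _ := irrCommGroup hpt
  obtain ⟨χ, hχ, hχf⟩ := exists_quadratic_character (G := Irr C) (f := Irr.of f) fun s hs => by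
    have h1 : Simple (s.rep ⊗ s.rep) := (hpt s.rep inferInstance).simple_tensor _
    have h2 : Simple (s.rep ⊗ s.rep ⊗ s.rep) := (hpt s.rep inferInstance).simple_tensor _
    have h3 : Simple (s.rep ⊗ s.rep ⊗ s.rep ⊗ s.rep) :=
      (hpt s.rep inferInstance).simple_tensor _
    have h4 : Simple ((s.rep ⊗ s.rep) ⊗ s.rep ⊗ s.rep) := Simple.of_iso (α_ _ _ _)
    obtain ⟨e⟩ := Irr.of_eq_of_iff.1 (hs : Irr.of (s.rep ⊗ s.rep) = Irr.of f)
    exact not_square_of_braiding_eq_neg hf hf' s.rep e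
  obtain ⟨θ, hθ, hsq, hten⟩ := exists_monoidal_involution hpt χ hχ
  refine ⟨⟨θ, hsq, hten⟩, (hθ f).trans ?_⟩
  rw [hχf]
  simp

end MugerDimension

/-! ### Invariance under equivalence -/

section Invariance

variable {C : Type u} [Category.{v} C] [Abelian C] {D : Type u'} [Category.{v'} D] [Abelian D]

/-- An equivalence induces a bijection between the classes of simple objects. -/
lemma exists_irr_equiv (F : C ⥤ D) [F.IsEquivalence] : Nonempty (Irr C ≃ Irr D) := by
  have hs : ∀ i : Irr C, Simple (F.obj i.rep) := fun i => simple_obj F _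
  refine ⟨Equiv.ofBijective (fun i => Irr.of (F.obj i.rep)) ⟨fun i j hij => ?_, fun i => ?_⟩⟩
  · obtain ⟨e⟩ := Irr.of_eq_of_iff.1 hij
    exact Irr.eq_iff.2 ⟨F.preimageIso e⟩
  · have e := F.objObjPreimageIso i.rep
    have : Simple (F.obj (F.objPreimage i.rep)) := Simple.of_iso e
    have : Simple (F.objPreimage i.rep) := (simple_obj_iff F _).1 this
    refine ⟨Irr.of (F.objPreimage i.rep), ?_⟩
    obtain ⟨e'⟩ := Irr.nonempty_rep_of_iso (F.objPreimage i.rep)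
    exact (Irr.of_eq (F.mapIso e' ≪≫ e)).trans (Irr.of_rep i)

variable [MonoidalCategory C] [MonoidalCategory D]

lemma IsFusion.of_isEquivalence (F : C ⥤ D) [F.IsEquivalence] [F.Monoidal]
    [F.Additive] [Linear ℂ C] [MonoidalPreadditive C] [MonoidalLinear ℂ C] [RigidCategory C]
    [Linear ℂ D] [MonoidalPreadditive D] [MonoidalLinear ℂ D] [RigidCategory D]
    [F.Linear ℂ] [IsFusion D] : IsFusion C where
  finiteDimensional_hom X Y :=
    LinearEquiv.finiteDimensional (LinearEquiv.ofBijective (F.mapLinearMap ℂ (X := X) (Y := Y))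
      ⟨F.map_injective, F.map_surjective⟩).symm
  semisimple X := by
    have := Abelian.hasFiniteBiproducts (C := C)
    refine IsSumOf.exists_biproduct (P := fun S : C => Simple S) ?_
    have : F.asEquivalence.functor.Additive := inferInstanceAs F.Additive
    have : F.inv.Additive := F.asEquivalence.inverse_additive
    have h := (isSumOf_simple (F.obj X)).map F.inv (Q := fun S : C => Simple S)
      fun S (_ : Simple S) => simple_obj F.inv S
    exact h.of_iso (F.asEquivalence.unitIso.app X).symm
  finite_irr := by
    obtain ⟨e⟩ := exists_irr_equiv F
    exact Finite.of_equiv _ e.symm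
  simple_unit := by
    have : Simple (F.obj (𝟙_ C)) := Simple.of_iso (Functor.Monoidal.εIso F).symm
    exact (simple_obj_iff F _).1 this

lemma IsPointed.of_isEquivalence (F : C ⥤ D) [F.IsEquivalence] [F.Monoidal] (h : IsPointed D) : IsPointed C := by
  intro X _
  obtain ⟨Y, ⟨a⟩, ⟨b⟩⟩ := h (F.obj X) (simple_obj F X)
  have e := F.objObjPreimageIso Y
  exact ⟨F.objPreimage Y,
    ⟨F.preimageIso ((Functor.Monoidal.μIso F _ _).symm ≪≫ whiskerLeftIso _ e ≪≫ a ≪≫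
      Functor.Monoidal.εIso F)⟩,
    ⟨F.preimageIso ((Functor.Monoidal.μIso F _ _).symm ≪≫ whiskerRightIso e _ ≪≫ b ≪≫
      Functor.Monoidal.εIso F)⟩⟩

end Invariance

section InvarianceTransparent

variable {C : Type u} [Category.{v} C] [MonoidalCategory C] [BraidedCategory C]
  {D : Type u'} [Category.{v'} D] [MonoidalCategory D] [BraidedCategory D]

/-- Each object of `D` is isomorphic to some `F.obj Z`, and the double braiding is natural along
that isomorphism. -/
lemma isTransparent_map (F : C ⥤ D) [F.Braided] [F.EssSurj] {X : C} (hX : isTransparent C X) :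
    isTransparent D (F.obj X) := by
  intro Y
  let e := F.objObjPreimageIso Y
  have h1 := congrArg F.map (hX (F.objPreimage Y))
  rw [F.map_comp, Functor.map_braiding, Functor.map_braiding, F.map_id] at h1
  have h2 : (β_ (F.obj (F.objPreimage Y)) (F.obj X)).hom ≫
      (β_ (F.obj X) (F.obj (F.objPreimage Y))).hom = 𝟙 _ := by
    rw [← cancel_epi (Functor.OplaxMonoidal.δ F _ _), ← cancel_mono (Functor.LaxMonoidal.μ F _ _)]
    simpa using h1
  have h3 := doubleBraiding_naturality_left e.inv (F.obj X)
  rw [h2, Category.comp_id] at h3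
  rw [← cancel_mono (e.inv ▷ F.obj X), Category.assoc, ← h3, Category.id_comp]

end InvarianceTransparent

/-! ### Replacing a category by an equivalent one with a prescribed type of objects -/

section Shrink

variable {T : Type u} {N : Type u'} [Category.{v} N] (F : T → N)
  [(inducedFunctor F).EssSurj]

instance : (inducedFunctor F).IsEquivalence where

/-- The induced category on `T`, equivalent to `N`. -/
abbrev inducedEquivalence : N ≌ InducedCategory N F := (inducedFunctor F).asEquivalence.symm

/-- The category on `T` induced from `N`, to which all structures of `N` are transported. -/
abbrev Induced [MonoidalCategory N] : Type u := Monoidal.Transported (inducedEquivalence F)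

namespace Induced

variable [MonoidalCategory N]

/-- The equivalence of the induced category with the original one. -/
abbrev incl : Induced F ⥤ N :=
  (Monoidal.equivalenceTransported (inducedEquivalence F)).inverse

instance [Preadditive N] : Preadditive (Induced F) :=
  inferInstanceAs (Preadditive (InducedCategory N F))

instance [Preadditive N] [Linear ℂ N] : Linear ℂ (Induced F) :=
  inferInstanceAs (Linear ℂ (InducedCategory N F))

instance [Preadditive N] : (incl F).Additive :=
  inferInstanceAs (inducedFunctor F).Additive

instance [Preadditive N] [Linear ℂ N] : (incl F).Linear ℂ :=
  inferInstanceAs ((inducedFunctor F).Linear ℂ)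

instance [Abelian N] : Abelian (Induced F) :=
  have : HasFiniteProducts (Induced F) :=
    ⟨fun _ => Adjunction.hasLimitsOfShape_of_equivalence (incl F)⟩
  abelianOfEquivalence (incl F)

instance [Preadditive N] [MonoidalPreadditive N] : MonoidalPreadditive (Induced F) :=
  monoidalPreadditive_of_faithful (incl F)

instance [Preadditive N] [Linear ℂ N] [MonoidalPreadditive N] [MonoidalLinear ℂ N] :
    MonoidalLinear ℂ (Induced F) :=
  MonoidalLinear.ofFaithful ℂ (incl F)

instance [RigidCategory N] : RigidCategory (Induced F) :=
  rigidCategoryOfEquivalence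
    (Monoidal.equivalenceTransported (inducedEquivalence F)).symm.toAdjunction

end Induced

/-- Assembling a minimal modular extension from a pointed braided fusion category in another
universe. -/
theorem nonempty_minimalModularExtension_of_functor {T : Type u} {N : Type u'} [Category.{v} N]
    (F : T → N) [(inducedFunctor F).EssSurj] {B : Type u} [Category.{v} B] [Abelian B]
    [Linear ℂ B] [MonoidalCategory B] [BraidedCategory B]
    [Abelian N] [Linear ℂ N] [MonoidalCategory N] [MonoidalPreadditive N] [MonoidalLinear ℂ N]
    [RigidCategory N] [BraidedCategory N] [IsFusion N] (hpt : IsPointed N)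
    (hN : ∀ S : N, Simple S → isTransparent N S → Nonempty (S ≅ 𝟙_ N))
    (J : B ⥤ N) [J.Braided] [J.Additive] [J.Linear ℂ] [J.Full] [J.Faithful]
    (hdim : (Nat.card (Irr N) : ℝ) = FPdim B * FPdim (MugerCenter B)) :
    Nonempty (MinimalModularExtension B) := by
  have hfus : IsFusion (Induced F) := IsFusion.of_isEquivalence (Induced.incl F)
  have hpt' : IsPointed (Induced F) := IsPointed.of_isEquivalence (Induced.incl F) hpt
  let G : N ⥤ Induced F := (Monoidal.equivalenceTransported (inducedEquivalence F)).functor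
  let e : Induced F ≌ N := (Monoidal.equivalenceTransported (inducedEquivalence F)).symm
  have : e.functor.Additive := inferInstanceAs (Induced.incl F).Additive
  have : e.functor.Linear ℂ := inferInstanceAs ((Induced.incl F).Linear ℂ)
  have : G.Additive := e.inverse_additive
  have : G.Linear ℂ := e.inverseLinear (R := ℂ)
  refine ⟨{ M := Induced F
            modular := ⟨hfus, nonempty_sphericalStructure hpt', ?_⟩
            embedding := J ⋙ G
            embedding_additive := inferInstance
            embedding_linear := inferInstance
            embedding_full := inferInstance
            embedding_faithful := inferInstance
            FPdim_eq := ?_ }⟩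
  · refine isNondegenerate_of_forall_simple fun S _ hS => ?_
    obtain ⟨e⟩ := hN ((Induced.incl F).obj S) (simple_obj _ S) (isTransparent_map _ hS)
    exact ⟨(Induced.incl F).preimageIso (e ≪≫ Functor.Monoidal.εIso (Induced.incl F))⟩
  · obtain ⟨e⟩ := exists_irr_equiv (Induced.incl F)
    rw [FPdim_eq_card_of_isPointed hpt', Nat.card_congr e, hdim]

end Shrink

/-! ### The category of objects with an involution -/

section SignObj

variable {C : Type u} [Category.{v} C] [Preadditive C]

/-- An object on which the generator of `ℤ/2ℤ` acts by a sign. -/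
abbrev signObj (ε : ℤˣ) (X : C) : Action C (Multiplicative (ZMod 2)) :=
  involutive X ((ε : ℤ) • 𝟙 X) (by
    rw [Preadditive.zsmul_comp, Category.id_comp, smul_smul, ← Units.val_mul, Int.units_mul_self,
      Units.val_one, one_smul])

@[simp]
lemma actionGen_signObj (ε : ℤˣ) (X : C) : actionGen (signObj ε X) = (ε : ℤ) • 𝟙 X :=
  actionGen_involutive _ _ _

/-- The functor `signObj ε`. -/
@[simps]
def signFunctor (C : Type u) [Category.{v} C] [Preadditive C] (ε : ℤˣ) :
    C ⥤ Action C (Multiplicative (ZMod 2)) where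
  obj X := signObj ε X
  map f := actionHomMk f (by simp)

instance (ε : ℤˣ) : (signFunctor C ε).Additive where
  map_add := by intros; ext; rfl

instance (ε : ℤˣ) [Linear ℂ C] : (signFunctor C ε).Linear ℂ where
  map_smul := by intros; ext; rfl

instance (ε : ℤˣ) : (signFunctor C ε).Faithful where
  map_injective h := congrArg (fun f => f.hom) h

instance (ε : ℤˣ) : (signFunctor C ε).Full where
  map_surjective f := ⟨f.hom, by ext; rfl⟩

/-- An isomorphism commuting with the generator is an isomorphism of actions. -/
def actionIsoMk {X Y : Action C (Multiplicative (ZMod 2))} (e : X.V ≅ Y.V)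
    (h : actionGen X ≫ e.hom = e.hom ≫ actionGen Y) : X ≅ Y :=
  Action.mkIso e (actionHomMk e.hom h).comm

lemma actionGen_tensor {D : Type u} [Category.{v} D] [MonoidalCategory D]
    (X Y : Action D (Multiplicative (ZMod 2))) :
    actionGen (X ⊗ Y) = actionGen X ⊗ₘ actionGen Y :=
  Action.tensor_ρ

variable [MonoidalCategory C] [MonoidalPreadditive C]

/-- The unit, as an object with trivial involution. -/
def signUnitIso : 𝟙_ (Action C (Multiplicative (ZMod 2))) ≅ signObj 1 (𝟙_ C) :=
  actionIsoMk (Iso.refl _) (by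
    have : actionGen (𝟙_ (Action C (Multiplicative (ZMod 2)))) = 𝟙 _ := rfl
    rw [this, actionGen_signObj]
    simp)

/-- Tensor products of objects on which the generator acts by signs. -/
def signTensorIso (ε δ : ℤˣ) (X Y : C) : signObj ε X ⊗ signObj δ Y ≅ signObj (ε * δ) (X ⊗ Y) :=
  actionIsoMk (Iso.refl _) (by
    rw [actionGen_tensor, actionGen_signObj, actionGen_signObj, actionGen_signObj]
    have h1 : ((ε : ℤ) • 𝟙 X) ▷ Y = (ε : ℤ) • 𝟙 (X ⊗ Y) := by
      rw [← id_whiskerRight]; exact (tensorRight Y).map_zsmul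
    have h2 : X ◁ ((δ : ℤ) • 𝟙 Y) = (δ : ℤ) • 𝟙 (X ⊗ Y) := by
      rw [← MonoidalCategory.whiskerLeft_id]; exact (tensorLeft X).map_zsmul
    have h3 : ((ε : ℤ) • 𝟙 X) ⊗ₘ ((δ : ℤ) • 𝟙 Y) = ((ε * δ : ℤˣ) : ℤ) • 𝟙 (X ⊗ Y) := by
      rw [MonoidalCategory.tensorHom_def, h1, h2, Preadditive.zsmul_comp, Category.id_comp,
        smul_smul, Units.val_mul]
    exact (Category.comp_id _).trans (h3.trans (Category.id_comp _).symm))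

end SignObj

/-! ### Eigenspace decomposition; objects with an involution form a pointed fusion category. -/

section Decomposition

variable {C : Type u} [Category.{v} C] [Abelian C] [Linear ℂ C]

/-- Every object with an involution is the sum of its two eigenspaces. -/
lemma exists_eigenspaces (X : Action C (Multiplicative (ZMod 2))) :
    ∃ (Y : ℤˣ → C) (i : ∀ ε, signObj ε (Y ε) ⟶ X) (p : ∀ ε, X ⟶ signObj ε (Y ε)),
      (∀ ε δ, i ε ≫ p δ = if h : ε = δ then eqToHom (by rw [h]) else 0) ∧
        ∑ ε, p ε ≫ i ε = 𝟙 X := by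
  let s : X.V ⟶ X.V := actionGen X
  have hs : s ≫ s = 𝟙 X.V := actionGen_sq X
  -- The eigenprojections `(1 + ε s) / 2` are complementary idempotents, and they split because `C`
  -- is abelian.
  let e : ℤˣ → (X.V ⟶ X.V) := fun ε => (2⁻¹ : ℂ) • (𝟙 X.V + (ε : ℤ) • s)
  have hee : ∀ ε, e ε ≫ e ε = e ε := by
    intro ε
    rcases Int.units_eq_one_or ε with rfl | rfl <;>
    · simp [e, hs]
      module
  have hes : ∀ ε, e ε ≫ s = (ε : ℤ) • e ε := by
    intro ε
    rcases Int.units_eq_one_or ε with rfl | rfl <;>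
    · simp [e, hs]
      try module
  have hse : ∀ ε, s ≫ e ε = (ε : ℤ) • e ε := by
    intro ε
    rcases Int.units_eq_one_or ε with rfl | rfl <;>
    · simp [e, hs]
      try module
  have hort : ∀ ε δ, ε ≠ δ → e ε ≫ e δ = 0 := by
    intro ε δ h
    rcases Int.units_eq_one_or ε with rfl | rfl <;> rcases Int.units_eq_one_or δ with rfl | rfl
    · exact absurd rfl h
    · simp [e, hs]
      try module
    · simp [e, hs]
      try module
    · exact absurd rfl h
  have htot : ∑ ε, e ε = 𝟙 X.V := by
    rw [Fintype.sum_eq_add (1 : ℤˣ) (-1) (by decide) (by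
      rintro ε ⟨h1, h2⟩
      rcases Int.units_eq_one_or ε with rfl | rfl <;> contradiction)]
    simp [e]
    module
  choose Y i p hip hpi using fun ε => IsIdempotentComplete.idempotents_split X.V (e ε) (hee ε)
  refine ⟨Y, fun ε => actionHomMk (i ε) ?_, fun ε => actionHomMk (p ε) ?_, fun ε δ => ?_, ?_⟩
  · have : i ε ≫ s = (ε : ℤ) • i ε := by
      have h : i ε ≫ e ε = i ε := by rw [← hpi, ← Category.assoc, hip, Category.id_comp]
      rw [← h, Category.assoc, hes, Preadditive.comp_zsmul]
    rw [actionGen_signObj, Preadditive.zsmul_comp, Category.id_comp]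
    exact this.symm
  · have : s ≫ p ε = (ε : ℤ) • p ε := by
      have h : e ε ≫ p ε = p ε := by rw [← hpi, Category.assoc, hip, Category.comp_id]
      rw [← h, ← Category.assoc, hse, Preadditive.zsmul_comp]
    rw [actionGen_signObj, Preadditive.comp_zsmul, Category.comp_id]
    exact this
  · by_cases h : ε = δ
    · subst h
      simp only [dite_true, eqToHom_refl]
      ext
      exact hip ε
    · rw [dif_neg h]
      ext
      change i ε ≫ p δ = 0
      calc i ε ≫ p δ = (i ε ≫ p ε) ≫ i ε ≫ p δ ≫ (i δ ≫ p δ) := by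
            rw [hip, hip]; simp
        _ = i ε ≫ (p ε ≫ i ε) ≫ (p δ ≫ i δ) ≫ p δ := by simp
        _ = 0 := by rw [hpi, hpi, reassoc_of% (hort ε δ h)]; simp
  · ext
    rw [Action.sum_hom]
    refine Eq.trans (Finset.sum_congr rfl fun ε _ => ?_) htot
    exact hpi ε

/-- Every object with an involution is isomorphic to one determined by a pair of objects. -/
lemma exists_iso_biproduct_signObj [HasFiniteBiproducts (Action C (Multiplicative (ZMod 2)))]
    (X : Action C (Multiplicative (ZMod 2))) :
    ∃ Y : ℤˣ → C, Nonempty ((⨁ fun ε => signObj ε (Y ε)) ≅ X) := by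
  obtain ⟨Y, i, p, horth, htot⟩ := exists_eigenspaces X
  refine ⟨Y, ⟨⟨biproduct.desc i, biproduct.lift p, ?_, ?_⟩⟩⟩
  · refine biproduct.hom_ext' _ _ fun l => biproduct.hom_ext _ _ fun k => ?_
    simp only [Category.assoc, biproduct.lift_π, biproduct.ι_desc_assoc, horth]
    rw [Category.id_comp, biproduct.ι_π]
  · rw [biproduct.lift_desc, htot]

/-- An equivariant isomorphism intertwines the two signs; if they differed, it would equal its own
negative. -/
lemma signObj_iso_iff {ε δ : ℤˣ} {S T : C} [Simple S] :
    Nonempty (signObj ε S ≅ signObj δ T) ↔ ε = δ ∧ Nonempty (S ≅ T) := by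
  constructor
  · rintro ⟨e⟩
    let e' : S ≅ T := (Action.forget C _).mapIso e
    refine ⟨?_, ⟨e'⟩⟩
    have h : actionGen (signObj ε S) ≫ e'.hom = e'.hom ≫ actionGen (signObj δ T) := e.hom.comm _
    rw [actionGen_signObj, actionGen_signObj, Preadditive.zsmul_comp, Preadditive.comp_zsmul,
      Category.id_comp, Category.comp_id] at h
    by_contra hne
    have h2 : (2 : ℂ) • e'.hom = 0 := by
      rcases Int.units_eq_one_or ε with rfl | rfl <;> rcases Int.units_eq_one_or δ with rfl | rfl
      · exact absurd rfl hne
      · simp at h; rw [two_smul]; nth_rewrite 1 [h]; simp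
      · simp at h; rw [two_smul]; nth_rewrite 1 [← h]; simp
      · exact absurd rfl hne
    have h3 := (smul_eq_zero.1 h2).resolve_left two_ne_zero
    exact id_nonzero S (by rw [← e'.hom_inv_id, h3, zero_comp])
  · rintro ⟨rfl, ⟨e⟩⟩
    exact ⟨(signFunctor C ε).mapIso e⟩

variable [MonoidalCategory C] [MonoidalPreadditive C] [MonoidalLinear ℂ C] [RigidCategory C]
  [IsFusion C]

/-- The simple objects with involution. -/
def IsSimpleSign (X : Action C (Multiplicative (ZMod 2))) : Prop :=
  ∃ (ε : ℤˣ) (S : C), Simple S ∧ X = signObj ε S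

instance simple_signObj (ε : ℤˣ) (S : C) [Simple S] : Simple (signObj ε S) := by
  have : (Action.forget C (Multiplicative (ZMod 2))).PreservesMonomorphisms :=
    inferInstance
  have : Simple ((Action.forget C (Multiplicative (ZMod 2))).obj (signObj ε S)) :=
    inferInstanceAs (Simple S)
  exact (Action.forget C (Multiplicative (ZMod 2))).simple_of_simple_obj _

lemma isSumOf_isSimpleSign (X : Action C (Multiplicative (ZMod 2))) : IsSumOf IsSimpleSign X := by
  obtain ⟨Y, i, p, horth, htot⟩ := exists_eigenspaces X
  have h : IsSumOf (fun Z => ∃ (ε : ℤˣ) (Y : C), Z = signObj ε Y) X :=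
    ⟨ℤˣ, inferInstance, inferInstance, fun ε => signObj ε (Y ε), i, p, fun ε => ⟨ε, Y ε, rfl⟩,
      horth, htot⟩
  refine h.trans ?_
  rintro _ ⟨ε, Y, rfl⟩
  exact (isSumOf_simple Y).map (signFunctor C ε) fun S hS => ⟨ε, S, hS, rfl⟩

lemma exists_iso_signObj_of_simple (X : Action C (Multiplicative (ZMod 2))) [Simple X] :
    ∃ (ε : ℤˣ) (S : C), Simple S ∧ Nonempty (X ≅ signObj ε S) := by
  obtain ⟨J, _, _, S, i, p, hS, horth, htot⟩ := isSumOf_isSimpleSign X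
  obtain ⟨k⟩ : Nonempty J := by
    by_contra h
    rw [not_nonempty_iff] at h
    exact id_nonzero X (by simpa using htot.symm)
  obtain ⟨ε, T, hT, hk⟩ := hS k
  have hk1 : i k ≫ p k = 𝟙 (S k) := by simp [horth]
  have : Simple (S k) := by rw [hk]; infer_instance
  have hk0 : i k ≠ 0 := by
    intro h
    exact id_nonzero (S k) (by rw [← hk1, h, zero_comp])
  have := isIso_of_hom_simple hk0
  exact ⟨ε, T, hT, ⟨(asIso (i k)).symm ≪≫ eqToIso hk⟩⟩

lemma exists_irr_signObj_equiv :
    Nonempty (ℤˣ × Irr C ≃ Irr (Action C (Multiplicative (ZMod 2)))) := by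
  refine ⟨Equiv.ofBijective (fun a => Irr.of (signObj a.1 a.2.rep)) ⟨?_, fun j => ?_⟩⟩
  · rintro ⟨ε, i⟩ ⟨δ, j⟩ h
    obtain ⟨h1, h2⟩ := signObj_iso_iff.1 (Irr.of_eq_of_iff.1 h)
    exact Prod.ext h1 (Irr.eq_iff.2 h2)
  · obtain ⟨ε, S, hS, ⟨e⟩⟩ := exists_iso_signObj_of_simple j.rep
    obtain ⟨e'⟩ := Irr.nonempty_rep_of_iso S
    let e2 : signObj ε (Irr.of S).rep ≅ j.rep := (signFunctor C ε).mapIso e' ≪≫ e.symm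
    refine ⟨(ε, Irr.of S), ?_⟩
    exact (Irr.of_eq e2).trans (Irr.of_rep j)

lemma card_irr_action :
    Nat.card (Irr (Action C (Multiplicative (ZMod 2)))) = 2 * Nat.card (Irr C) := by
  obtain ⟨e⟩ := exists_irr_signObj_equiv (C := C)
  rw [← Nat.card_congr e, Nat.card_prod]
  simp

instance isFusion_action : IsFusion (Action C (Multiplicative (ZMod 2))) where
  finiteDimensional_hom X Y :=
    FiniteDimensional.of_injective ((Action.forget C _).mapLinearMap ℂ (X := X) (Y := Y))
      (Action.forget C _).map_injective
  semisimple X := by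
    have := Abelian.hasFiniteBiproducts (C := Action C (Multiplicative (ZMod 2)))
    obtain ⟨n, S, hS, h⟩ := (isSumOf_isSimpleSign X).exists_biproduct
    refine ⟨n, S, fun k => ?_, h⟩
    obtain ⟨ε, T, hT, hk⟩ := hS k
    rw [hk]
    infer_instance
  finite_irr := by
    obtain ⟨e⟩ := exists_irr_signObj_equiv (C := C)
    exact Finite.of_equiv _ e
  simple_unit := Simple.of_iso signUnitIso

lemma IsPointed.action (h : IsPointed C) : IsPointed (Action C (Multiplicative (ZMod 2))) := by
  intro X _
  obtain ⟨ε, S, hS, ⟨e⟩⟩ := exists_iso_signObj_of_simple X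
  obtain ⟨T, ⟨a⟩, ⟨b⟩⟩ := h S hS
  have key : ∀ {S T : C} (_ : S ⊗ T ≅ 𝟙_ C),
      Nonempty (signObj ε S ⊗ signObj ε T ≅ 𝟙_ (Action C (Multiplicative (ZMod 2)))) := by
    intro S T a
    have e1 := signTensorIso ε ε S T
    rw [Int.units_mul_self] at e1
    exact ⟨e1 ≪≫ (signFunctor C 1).mapIso a ≪≫ signUnitIso.symm⟩
  have : IsInvertibleObj (signObj ε S) := ⟨signObj ε T, key a, key b⟩
  exact this.of_iso e.symm

end Decomposition

/-! ### The twisted braiding on objects with an involution -/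

section Involutions

variable {C : Type u} [Category.{v} C] [MonoidalCategory C]

/-- Both whiskerings of `θ` at the unit equal `θ` at `𝟙_ C ⊗ 𝟙_ C` by naturality of the unitors.
Tensor compatibility then says that this map equals its own square, which is `1`. -/
lemma MonoidalInvolution.at_unit (θ : MonoidalInvolution C) : θ.at (𝟙_ C) = 𝟙 _ := by
  have h1 := θ.at_tensor (𝟙_ C) (𝟙_ C)
  have h2 : θ.at (𝟙_ C) ▷ 𝟙_ C = θ.at (𝟙_ C ⊗ 𝟙_ C) := by
    rw [← cancel_mono (ρ_ (𝟙_ C)).hom, rightUnitor_naturality, θ.at_comp]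
  have h3 : 𝟙_ C ◁ θ.at (𝟙_ C) = θ.at (𝟙_ C ⊗ 𝟙_ C) := by
    rw [← cancel_mono (λ_ (𝟙_ C)).hom, leftUnitor_naturality, θ.at_comp]
  rw [h2, h3, θ.at_sq] at h1
  rw [h1] at h3
  rw [← cancel_epi (λ_ (𝟙_ C)).hom, ← leftUnitor_naturality, h3]
  simp

/-- The action of the generator of `ℤ/2ℤ` as a monoidal involution. -/
def generatorInvolution (C : Type u) [Category.{v} C] [MonoidalCategory C] :
    MonoidalInvolution (Action C (Multiplicative (ZMod 2))) where
  toNatTrans := { app X := actionHomMk (actionGen X) rfl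
                  naturality X Y f := by ext; exact (f.comm _).symm }
  sq X := by ext; exact actionGen_sq X
  tensor X Y := by ext; exact actionGen_tensor X Y

/-- A monoidal involution acts on objects with an involution. -/
def MonoidalInvolution.action (θ : MonoidalInvolution C) :
    MonoidalInvolution (Action C (Multiplicative (ZMod 2))) where
  toNatTrans := { app X := actionHomMk (θ.at X.V) (θ.at_comp _).symm
                  naturality X Y f := by ext; exact (θ.at_comp _).symm }
  sq X := by ext; exact θ.sq X.V
  tensor X Y := by ext; exact θ.tensor X.V Y.V

/-- Objects with an involution, to be endowed with the braiding twisted by `θ`. -/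
def TwistedAction (_ : MonoidalInvolution C) : Type (max u v) :=
  Action C (Multiplicative (ZMod 2))

end Involutions

/-! ### The twisted category: braiding, embedding of `C`, and non-degeneracy. -/

namespace TwistedAction

variable {C : Type u} [Category.{v} C] [Abelian C] [Linear ℂ C] [MonoidalCategory C]
  (θ : MonoidalInvolution C)

instance : Category.{v} (TwistedAction θ) :=
  inferInstanceAs (Category.{v} (Action C (Multiplicative (ZMod 2))))
instance : Abelian (TwistedAction θ) :=
  inferInstanceAs (Abelian (Action C (Multiplicative (ZMod 2))))
instance : Linear ℂ (TwistedAction θ) :=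
  inferInstanceAs (Linear ℂ (Action C (Multiplicative (ZMod 2))))
instance : MonoidalCategory (TwistedAction θ) :=
  inferInstanceAs (MonoidalCategory (Action C (Multiplicative (ZMod 2))))
instance [MonoidalPreadditive C] : MonoidalPreadditive (TwistedAction θ) :=
  inferInstanceAs (MonoidalPreadditive (Action C (Multiplicative (ZMod 2))))
/-- An object with an involution, as an object of the twisted category. -/
abbrev mk (θ : MonoidalInvolution C) (X : Action C (Multiplicative (ZMod 2))) :
    TwistedAction θ := X

lemma exists_iso_biproduct [HasFiniteBiproducts (TwistedAction θ)] (X : TwistedAction θ) :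
    ∃ Y : ℤˣ → C, Nonempty ((⨁ fun ε => mk θ (signObj ε (Y ε))) ≅ X) :=
  have : HasFiniteBiproducts (Action C (Multiplicative (ZMod 2))) :=
    inferInstanceAs (HasFiniteBiproducts (TwistedAction θ))
  exists_iso_biproduct_signObj X

variable [MonoidalPreadditive C] [MonoidalLinear ℂ C]

instance : MonoidalLinear ℂ (TwistedAction θ) :=
  inferInstanceAs (MonoidalLinear ℂ (Action C (Multiplicative (ZMod 2))))
instance [RigidCategory C] : RigidCategory (TwistedAction θ) :=
  inferInstanceAs (RigidCategory (Action C (Multiplicative (ZMod 2))))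
instance [RigidCategory C] [IsFusion C] : IsFusion (TwistedAction θ) :=
  inferInstanceAs (IsFusion (Action C (Multiplicative (ZMod 2))))

variable [BraidedCategory C]

instance : BraidedCategory (TwistedAction θ) :=
  (twistedBraiding (C := Action C (Multiplicative (ZMod 2))) (generatorInvolution C) θ.action :)

/-- The underlying morphism. -/
abbrev fwd {X Y : TwistedAction θ} (f : X ⟶ Y) : Action.V X ⟶ Action.V Y := Action.Hom.hom f

lemma braiding_hom (X Y : Action C (Multiplicative (ZMod 2))) :
    fwd θ (β_ (mk θ X) (mk θ Y)).hom =
      signOp (actionGen X ▷ Y.V) (X.V ◁ θ.at Y.V) ≫ (β_ X.V Y.V).hom := by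
  have h := map_signOp (Action.forget C (Multiplicative (ZMod 2)))
    ((generatorInvolution C).at X ▷ Y) (X ◁ θ.action.at Y)
  exact congrArg (fun a => a ≫ (β_ X.V Y.V).hom) h

/-- An even first factor switches the twist off, whatever the second factor. This is why the
embedding of `C` is braided. -/
lemma braiding_signObj_one (X : C) (Y : Action C (Multiplicative (ZMod 2))) :
    fwd θ (β_ (mk θ (signObj 1 X)) (mk θ Y)).hom = (β_ X Y.V).hom := by
  have h : actionGen (signObj 1 X) = 𝟙 X := by simp
  rw [braiding_hom, h]
  exact (congrArg (· ≫ (β_ X Y.V).hom) (by rw [id_whiskerRight, signOp_id_left])).trans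
    (Category.id_comp _)

/-- The embedding of `C` as the objects with trivial involution. -/
def embedding : C ⥤ TwistedAction θ := signFunctor C 1

instance : (embedding θ).Additive := inferInstanceAs (signFunctor C 1).Additive
instance : (embedding θ).Linear ℂ := inferInstanceAs ((signFunctor C 1).Linear ℂ)
instance : (embedding θ).Full := inferInstanceAs (signFunctor C 1).Full
instance : (embedding θ).Faithful := inferInstanceAs (signFunctor C 1).Faithful

instance : (embedding θ).Monoidal :=
  Functor.CoreMonoidal.toMonoidal
    { εIso := signUnitIso
      μIso X Y := signTensorIso 1 1 X Y
      μIso_hom_natural_left f Z := by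
        apply Action.hom_ext
        exact (Category.comp_id (f ▷ Z)).trans (Category.id_comp (f ▷ Z)).symm
      μIso_hom_natural_right Z f := by
        apply Action.hom_ext
        exact (Category.comp_id (Z ◁ f)).trans (Category.id_comp (Z ◁ f)).symm
      associativity X Y Z := by
        apply Action.hom_ext
        have h : (α_ (signObj 1 X) (signObj 1 Y) (signObj 1 Z)).hom.hom = (α_ X Y Z).hom :=
          Action.associator_hom_hom _ _ _
        have h1 : 𝟙 (X ⊗ Y) ▷ Z ≫ 𝟙 _ ≫ (α_ X Y Z).hom =
          (α_ X Y Z).hom ≫ X ◁ 𝟙 (Y ⊗ Z) ≫ 𝟙 _ := by simp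
        exact h1.trans (congrArg (· ≫ X ◁ 𝟙 (Y ⊗ Z) ≫ 𝟙 _) h.symm)
      left_unitality X := by
        apply Action.hom_ext
        have h : (λ_ (signObj 1 X)).hom.hom = (λ_ X).hom := Action.leftUnitor_hom_hom _
        have h1 : (λ_ X).hom = 𝟙 (𝟙_ C) ▷ X ≫ 𝟙 _ ≫ (λ_ X).hom := by simp
        exact h.trans h1
      right_unitality X := by
        apply Action.hom_ext
        have h : (ρ_ (signObj 1 X)).hom.hom = (ρ_ X).hom := Action.rightUnitor_hom_hom _
        have h1 : (ρ_ X).hom = X ◁ 𝟙 (𝟙_ C) ≫ 𝟙 _ ≫ (ρ_ X).hom := by simp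
        exact h.trans h1 }

instance : (embedding θ).Braided where
  braided X Y := by
    apply Action.hom_ext
    have h : fwd θ (β_ (mk θ (signObj 1 X)) (mk θ (signObj 1 Y))).hom = (β_ X Y).hom := by
      rw [braiding_signObj_one]
    exact (Category.id_comp (β_ X Y).hom).trans (h.symm.trans (Category.comp_id _).symm)

variable {θ}

/-- The transparent simple objects of the twisted category are trivial. -/
lemma nonempty_iso_unit_of_isTransparent [RigidCategory C] [IsFusion C] (hpt : IsPointed C) {f : C} [Simple f]
    (hf : isTransparent C f)
    (hcl : ∀ S : C, Simple S → isTransparent C S → Nonempty (S ≅ 𝟙_ C) ∨ Nonempty (S ≅ f))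
    (hθ : θ.at f = -𝟙 f) (X : TwistedAction θ) (hX : Simple X)
    (hX' : isTransparent (TwistedAction θ) X) : Nonempty (X ≅ 𝟙_ (TwistedAction θ)) := by
  obtain ⟨ε, S, hS, ⟨e⟩⟩ :=
    @exists_iso_signObj_of_simple C _ _ _ _ _ _ _ _ (X : Action C (Multiplicative (ZMod 2))) hX
  have hT : isTransparent (TwistedAction θ) (mk θ (signObj ε S)) :=
    isTransparent_of_iso hX' (Iso.symm (C := TwistedAction θ) e)
  have hfwd : ∀ (δ : ℤˣ) (T : C), signOp (((δ : ℤ) • 𝟙 T) ▷ S) (T ◁ θ.at S) ≫ (β_ T S).hom ≫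
      signOp (((ε : ℤ) • 𝟙 S) ▷ T) (S ◁ θ.at T) ≫ (β_ S T).hom = 𝟙 (T ⊗ S) := by
    intro δ T
    have h := congrArg (fwd θ) (hT (mk θ (signObj δ T)))
    have h' : fwd θ (β_ (mk θ (signObj δ T)) (mk θ (signObj ε S))).hom ≫
        fwd θ (β_ (mk θ (signObj ε S)) (mk θ (signObj δ T))).hom = 𝟙 (T ⊗ S) := h
    rw [braiding_hom, braiding_hom, actionGen_signObj, actionGen_signObj] at h'
    exact (Category.assoc _ _ _).symm.trans h'
  have hneg : ∀ {Z : C} [Simple Z], 𝟙 Z = -𝟙 Z → False := by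
    intro Z _ h
    have h2 : (2 : ℂ) • 𝟙 Z = 0 := by rw [two_smul]; nth_rewrite 1 [h]; exact neg_add_cancel _
    exact id_nonzero Z ((smul_eq_zero.1 h2).resolve_left two_ne_zero)
  have hpos : ∀ X Y : C, (((1 : ℤˣ) : ℤ) • 𝟙 X) ▷ Y = 𝟙 (X ⊗ Y) := by
    intro X Y; simp
  have hmin : ∀ X Y : C, (((-1 : ℤˣ) : ℤ) • 𝟙 X) ▷ Y = -𝟙 (X ⊗ Y) := by
    intro X Y
    have h : ((-1 : ℤˣ) : ℤ) • 𝟙 X = -𝟙 X := by simp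
    rw [h, ← id_whiskerRight]
    exact (tensorRight Y).map_neg
  -- Test against the odd unit `(-1, 𝟙)`: the braiding of `C` with the unit contributes nothing and
  -- only `θ` on `S` remains.
  have h1 : θ.at S = 𝟙 S := by
    have h := hfwd (-1) (𝟙_ C)
    have hβ : (β_ (𝟙_ C) S).hom ≫ (β_ S (𝟙_ C)).hom = 𝟙 _ := by simp
    rw [hmin, signOp_neg_id_left, θ.at_unit, MonoidalCategory.whiskerLeft_id, signOp_id_right,
      Category.id_comp, hβ, Category.comp_id] at h
    rw [← cancel_epi (λ_ S).hom, ← leftUnitor_naturality, h]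
    simp
  rcases Int.units_eq_one_or ε with rfl | rfl
  -- Among even objects nothing is twisted, so `S` is transparent in `C`; the case `S ≅ f`
  -- contradicts `θ = 1` on `S`.
  · have hS' : isTransparent C S := by
      intro T
      have h := hfwd 1 T
      rwa [hpos, hpos, signOp_id_left, signOp_id_left, Category.id_comp, Category.id_comp] at h
    rcases hcl S hS hS' with ⟨⟨a⟩⟩ | ⟨⟨a⟩⟩
    · exact ⟨Iso.trans (C := TwistedAction θ) e ((embedding θ).mapIso a ≪≫ signUnitIso.symm)⟩
    · have h2 := θ.at_comp a.hom
      rw [h1, hθ, Category.id_comp, Preadditive.comp_neg, Category.comp_id] at h2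
      refine (hneg (Z := f) ?_).elim
      rw [← cancel_epi a.hom, Preadditive.comp_neg, Category.comp_id]
      exact h2
  -- For odd `X`, test against the even fermion: `f` is transparent in `C`, so the double braiding
  -- is `θ` on `f`, that is `-1` instead of `1`.
  · have h := hfwd 1 f
    have hw : S ◁ θ.at f = -𝟙 (S ⊗ f) := by
      rw [hθ, ← MonoidalCategory.whiskerLeft_id]
      exact (tensorLeft S).map_neg
    have hβ : (β_ f S).hom ≫ (β_ S f).hom = 𝟙 _ := by
      rw [← cancel_mono (β_ f S).hom, Category.assoc, hf S]
      simp
    have := (hpt f inferInstance).simple_tensor S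
    rw [hpos, hmin, signOp_id_left, signOp_neg_id_left, hw, Category.id_comp, Preadditive.neg_comp,
      Category.id_comp, Preadditive.comp_neg, hβ] at h
    exact (hneg h.symm).elim

end TwistedAction

/-- A slightly degenerate pointed braided fusion category has a minimal modular extension. -/
theorem nonempty_minimalModularExtension (B : Type u) [Category.{v} B] [Abelian B] [Linear ℂ B]
    [MonoidalCategory B] [MonoidalPreadditive B] [MonoidalLinear ℂ B] [RigidCategory B]
    [BraidedCategory B] [IsFusion B]
    (hdeg : IsSlightlyDegenerate B) (hpt : IsPointed B) :
    Nonempty (MinimalModularExtension B) := by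
  obtain ⟨f, _, hf, hβ, hcl⟩ := exists_fermion hdeg
  obtain ⟨θ, hθ⟩ := exists_involution_of_isSlightlyDegenerate hpt hβ hf
  have := Abelian.hasFiniteBiproducts (C := TwistedAction θ)
  -- Objects of `TwistedAction θ` live in `Type (max u v)`, whereas those of the extension must lie
  -- in `Type u`. Pairs of eigenspaces lie in `Type u` and reach every object up to isomorphism.
  let F : (ℤˣ → B) → TwistedAction θ := fun Y => ⨁ fun ε => TwistedAction.mk θ (signObj ε (Y ε))
  have : (inducedFunctor F).EssSurj :=
    ⟨fun X => let ⟨Y, ⟨e⟩⟩ := TwistedAction.exists_iso_biproduct θ X; ⟨Y, ⟨e⟩⟩⟩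
  have hptN : IsPointed (TwistedAction θ) := hpt.action
  refine nonempty_minimalModularExtension_of_functor F hptN
    (TwistedAction.nonempty_iso_unit_of_isTransparent hpt hf hcl hθ)
    (TwistedAction.embedding θ) ?_
  have hcard : Nat.card (Irr (TwistedAction θ)) = 2 * Nat.card (Irr B) := card_irr_action
  rw [hcard, FPdim_eq_card_of_isPointed hpt,
    FPdim_mugerCenter_eq_two hpt hf (not_iso_unit_of_braiding_eq_neg hβ) hcl]
  push_cast
  ring

end FusionCat

end

theorem mainTheorem10 (B : Type u) [Category.{v} B] [Abelian B] [Linear ℂ B]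
    [MonoidalCategory B] [MonoidalPreadditive B] [MonoidalLinear ℂ B] [RigidCategory B]
    [BraidedCategory B] [FusionCat.IsFusion B]
    (hdeg : FusionCat.IsSlightlyDegenerate B) (hpt : FusionCat.IsPointed B) :
    Nonempty (FusionCat.MinimalModularExtension B) :=
  FusionCat.nonempty_minimalModularExtension B hdeg hpt
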